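/- A mixed graph $G=(V;D,L)$ is a finite loopless graph whose edges are of two kinds, direction edges ($D$) and length edges ($L$); parallel edges are allowed only if they are of different kinds. For $p:V\to\mathbb{R}^2$, the frameworks $(G,p)$ and $(G,q)$ are equivalent if $p(u)-p(v)$ is a scalar multiple of $q(u)-q(v)$ for all $uv\in D$ with $q(u)\ne q(v)$, and $\|p(u)-p(v)\|=\|q(u)-q(v)\|$ for all $uv\in L$; $p$ and $q$ are congruent if $p(u)-p(v)=q(u)-q(v)$ for all $u,v\in V$, or $p(u)-p(v)=q(v)-q(u)$ for all $u,v\in V$. The framework $(G,p)$ is rigid if for some $\varepsilon>0$ every $q$ such that $(G,q)$ is equivalent to $(G,p)$ and $\|p(v)-q(v)\|<\varepsilon$ for all $v\in V$ is congruent to $p$, and it is redundantly rigid if $(G-e,p)$ is rigid for every edge $e\in D\cup L$. Call $p$ generic if its $2|V|$ coordinates are algebraically independent over $\mathbb{Q}$. The graph $G$ is redundantly rigid if some (equivalently, every) generic $(G,p)$ is. The rigidity matrix $R(G,p)$ has one row for each edge and two columns for each vertex; with $p(u)-p(v)=(a,b)$, the row of $uv\in L$ has entries $(a,b)$ at $u$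 and $(-a,-b)$ at $v$, the row of $uv\in D$ has entries $(b,-a)$ at $u$ and $(-b,a)$ at $v$, and all other entries are $0$. The rigidity matroid $M(G)$ is the matroid on $D\cup L$ of linear independence of the rows of $R(G,p)$ for generic $p$ (it does not depend on the choice of the generic $p$). $G$ is $M$-connected if $M(G)$ is connected, i.e. any two edges of $G$ lie in a common circuit of $M(G)$. $G$ is direction irreducible if (R1) no $e\in D$ belongs to a circuit of $M(G)$ that consists of direction edges only, and (R2) there is no proper induced subgraph $H$ of $G$ (on a non-empty vertex set different from $V$) such that the multigraph $G/H$, obtained by contracting $H$ to a single vertex (deleting the edges of $H$ and keeping all other edges), has only direction edges and is the union of two edge-disjoint spanning trees. $G$ is $2$-connected if $|V|\ge 3$, $G$ is connected, and $G-v$ is connected for every $v\in V$. $G$ is direction-balanced if, whenever $H_1,H_2$ are subgraphs with $G=H_1\cup H_2$, $V(H_1)\cap V(H_2)=\{u,v\}$ with $u\neq v$, and $V(H_1)\setminus V(H_2)\ne\emptyset\ne V(H_2)\setminus V(H_1)$, both $H_1$ and $H_2$ contain a direction edge of $G$ distinct from $uv$. **Lemma.** Let $G=(V;D,L)$ be a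 direction irreducible, $2$-connected, direction-balanced mixed graph with $D\neq\emptyset$. Then $G$ is $M$-connected if and only if $G$ is redundantly rigid. -/

import Mathlib

/-- A mixed graph `G = (V; D, L)` without loops. There is at most one direction edge and at most
one length edge between two vertices; a direction edge may be parallel to a length edge. -/
@[ext] structure MixedGraph (V : Type*) where
  /-- the direction edges -/
  D : SimpleGraph V
  /-- the length edges -/
  L : SimpleGraph V

/-- Labels of potential edges of a mixed graph on `V`: `Sum.inl s(u, v)` is the direction edge `uv`
and `Sum.inr s(u, v)` is the length edge `uv`. -/
abbrev MixedEdge (V : Type*) := Sym2 V ⊕ Sym2 V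

/-- The plane, with its Euclidean norm. -/
abbrev Plane := EuclideanSpace ℝ (Fin 2)

namespace MixedEdge

/-- The unordered pair of end vertices of an edge. -/
def ends {V : Type*} (e : MixedEdge V) : Sym2 V := Sum.elim id id e

/-- `e` is a direction edge. -/
def IsDir {V : Type*} (e : MixedEdge V) : Prop := ∃ s : Sym2 V, e = Sum.inl s

open Classical in
/-- The row of the rigidity matrix at `p` that belongs to an edge. Write `p u - p v = (a, b)`.
A length edge `uv` has entries `(a, b)` at `u` and `(-a, -b)` at `v`; a direction edge `uv` has
entries `(b, -a)` at `u` and `(-b, a)` at `v`; all other entries are zero. (The row does not depend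
on the orientation of the edge.) -/
noncomputable def row {V : Type*} (p : V → Plane) : MixedEdge V → V × Fin 2 → ℝ
  | Sum.inl e => Sym2.lift
      ⟨fun u v x =>
        (if x.1 = u then ![(p u - p v) 1, -(p u - p v) 0] x.2 else 0) +
        (if x.1 = v then ![(p v - p u) 1, -(p v - p u) 0] x.2 else 0),
        fun _ _ => funext fun _ => add_comm _ _⟩ e
  | Sum.inr e => Sym2.lift
      ⟨fun u v x =>
        (if x.1 = u then (p u - p v) x.2 else 0) + (if x.1 = v then (p v - p u) x.2 else 0),
        fun _ _ => funext fun _ => add_comm _ _⟩ e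

end MixedEdge

/-- A multigraph is a tree if it has no loops and no parallel edges and is, as a simple graph,
connected and acyclic. -/
def Graph.IsTree {α β : Type*} (M : Graph α β) : Prop :=
  ∃ _ : M.Simple, M.toSimpleGraph.IsTree

/-- `T` is the edge set of a spanning tree of the multigraph `M`. -/
def Graph.IsSpanningTree {α β : Type*} (M : Graph α β) (T : Set β) : Prop :=
  T ⊆ M.edgeSet ∧ (M.restrict T).IsTree

/-- A matroid is connected if any two elements of its ground set lie in a common circuit. -/
def Matroid.IsConnected {α : Type*} (M : Matroid α) : Prop :=
  ∀ e ∈ M.E, ∀ f ∈ M.E, e ≠ f → ∃ C, M.IsCircuit C ∧ e ∈ C ∧ f ∈ C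

/-- `p` is generic: the coordinates of its points are algebraically independent over `ℚ`. -/
def IsGeneric {V : Type*} (p : V → Plane) : Prop :=
  AlgebraicIndependent ℚ fun x : V × Fin 2 => p x.1 x.2

/-- Generic configurations exist. -/
theorem exists_isGeneric (V : Type*) [Finite V] : ∃ p : V → Plane, IsGeneric p := by
  obtain ⟨s, hs⟩ := exists_isTranscendenceBasis ℚ ℝ
  have hinf : Infinite s := by
    by_contra hfin
    rw [not_infinite_iff_finite] at hfin
    have hcard : Cardinal.mk ℝ ≤ Cardinal.aleph0 := by
      rcases isEmpty_or_nonempty s with he | hne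
      · have halg : Algebra.IsAlgebraic ℚ ℝ := (hs.isEmpty_iff_isAlgebraic).1 he
        simpa using Algebra.IsAlgebraic.cardinalMk_le_max ℚ ℝ
      · have h := hs.lift_cardinalMk_eq_max_lift
        simp only [Cardinal.lift_uzero] at h
        rw [h]
        simp
    exact absurd hcard (not_le.2 (by simp))
  obtain ⟨n, ⟨φ⟩⟩ := Finite.exists_equiv_fin (V × Fin 2)
  let ψ : V × Fin 2 → s := fun x => Infinite.natEmbedding s (φ x)
  have hψ : Function.Injective ψ := fun x y hxy => by
    have := (Infinite.natEmbedding s).injective hxy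
    exact φ.injective (Fin.ext this)
  exact ⟨fun v => WithLp.toLp 2 fun i => (ψ (v, i) : ℝ), hs.1.comp ψ hψ⟩

/-- Two configurations are congruent if they differ by a translation, possibly followed by a
rotation by 180 degrees. -/
def PointCongruent {V : Type*} (p q : V → Plane) : Prop :=
  (∀ u v, p u - p v = q u - q v) ∨ (∀ u v, p u - p v = q v - q u)

namespace MixedGraph

/-- The edge set `D ∪ L`, as a set of labelled edges. -/
def edges {V : Type*} (G : MixedGraph V) : Set (MixedEdge V) :=
  Sum.inl '' G.D.edgeSet ∪ Sum.inr '' G.L.edgeSet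

/-- The graph `G - e`. -/
def deleteEdge {V : Type*} (G : MixedGraph V) (e : MixedEdge V) : MixedGraph V where
  D := G.D.deleteEdges {s | Sum.inl s = e}
  L := G.L.deleteEdges {s | Sum.inr s = e}

/-! ### Rigidity -/

/-- The direction-length frameworks `(G, p)` and `(G, q)` are equivalent. -/
def Equivalent {V : Type*} (G : MixedGraph V) (p q : V → Plane) : Prop :=
  (∀ u v, G.D.Adj u v → q u ≠ q v → ∃ c : ℝ, p u - p v = c • (q u - q v)) ∧
  (∀ u v, G.L.Adj u v → ‖p u - p v‖ = ‖q u - q v‖)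

/-- The framework `(G, p)` is rigid. -/
def FrameworkRigid {V : Type*} (G : MixedGraph V) (p : V → Plane) : Prop :=
  ∃ ε > 0, ∀ q : V → Plane, G.Equivalent p q → (∀ v, ‖p v - q v‖ < ε) → PointCongruent p q

/-- The framework `(G, p)` is redundantly rigid: `(G - e, p)` is rigid for every edge `e`. -/
def FrameworkRedundantlyRigid {V : Type*} (G : MixedGraph V) (p : V → Plane) : Prop :=
  ∀ e ∈ G.edges, (G.deleteEdge e).FrameworkRigid p

/-- The mixed graph `G` is redundantly rigid: some generic realisation of it is. -/
def RedundantlyRigid {V : Type*} (G : MixedGraph V) : Prop :=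
  ∃ p : V → Plane, IsGeneric p ∧ G.FrameworkRedundantlyRigid p

/-! ### The rigidity matroid -/

/-- The rigidity matroid of the framework `(G, p)`: the ground set is the edge set of `G`, and a set
of edges is independent if the corresponding rows of the rigidity matrix are linearly independent. -/
noncomputable def frameworkMatroid {V : Type*} [Finite V] (G : MixedGraph V) (p : V → Plane) :
    Matroid (MixedEdge V) :=
  (IndepMatroid.ofFinite (E := G.edges) (Set.toFinite _)
    (fun I => I ⊆ G.edges ∧ LinearIndepOn ℝ (MixedEdge.row p) I)
    ⟨Set.empty_subset _, linearIndepOn_empty _ _⟩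
    (fun _ _ hJ hIJ => ⟨hIJ.trans hJ.1, hJ.2.mono hIJ⟩)
    (by
      rintro I J ⟨hIE, hI⟩ ⟨hJE, hJ⟩ hlt
      by_contra! hcon
      have hspan : ∀ e ∈ J, MixedEdge.row p e ∈ Submodule.span ℝ (MixedEdge.row p '' I) := by
        intro e he
        by_cases heI : e ∈ I
        · exact Submodule.subset_span ⟨e, heI, rfl⟩
        · by_contra hns
          exact hcon e he heI (Set.insert_subset_iff.2 ⟨hJE he, hIE⟩) (hI.insert hns)
      have hle : Submodule.span ℝ (MixedEdge.row p '' J) ≤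
          Submodule.span ℝ (MixedEdge.row p '' I) := by
        rw [Submodule.span_le]
        rintro _ ⟨e, he, rfl⟩
        exact hspan e he
      have key : ∀ K : Set (MixedEdge V), LinearIndepOn ℝ (MixedEdge.row p) K →
          Module.finrank ℝ (Submodule.span ℝ (MixedEdge.row p '' K)) = K.ncard := by
        intro K hK
        have : Fintype K := Fintype.ofFinite K
        have h := finrank_span_eq_card (R := ℝ) hK
        rw [← Nat.card_coe_set_eq, Nat.card_eq_fintype_card, ← h, Set.image_eq_range]
      have h := Submodule.finrank_mono hle
      rw [key J hJ, key I hI] at h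
      omega)
    (fun _ hI => hI.1)).matroid

/-- The rigidity matroid `M(G)`: the rigidity matroid of a generic realisation of `G`. (All generic
realisations of `G` have the same rigidity matroid.) -/
noncomputable def rigidityMatroid {V : Type*} [Finite V] (G : MixedGraph V) :
    Matroid (MixedEdge V) :=
  G.frameworkMatroid (exists_isGeneric V).choose

/-- `G` is `M`-connected: its rigidity matroid is connected. -/
def MConnected {V : Type*} [Finite V] (G : MixedGraph V) : Prop :=
  G.rigidityMatroid.IsConnected

/-! ### Direction reductions -/

/-- `G`, with its direction and length edges, as a multigraph. -/
def toGraph {V : Type*} (G : MixedGraph V) : Graph V (MixedEdge V) where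
  vertexSet := Set.univ
  edgeSet := G.edges
  IsLink e x y := e ∈ G.edges ∧ e.ends = s(x, y)
  isLink_symm _ _ := ⟨fun _ _ h => ⟨h.1, h.2.trans Sym2.eq_swap⟩⟩
  eq_or_eq_of_isLink_of_isLink _ _ _ _ _ h h' := by
    have := h.2.symm.trans h'.2
    rw [Sym2.eq_iff] at this
    tauto
  edge_mem_iff_exists_isLink e := by
    constructor
    · intro he
      obtain ⟨⟨x, y⟩, h⟩ := Sym2.mk_surjective e.ends
      exact ⟨x, y, he, h.symm⟩
    · rintro ⟨x, y, he, -⟩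
      exact he
  left_mem_of_isLink _ _ _ _ := Set.mem_univ _

open Classical in
/-- The multigraph `G/H`, where `H` is the subgraph of `G` induced by `U`: all edges of `H` are
deleted and the vertices in `U` are identified to one new vertex `none`; all other edges are kept,
possibly as parallel edges. -/
noncomputable def contract {V : Type*} (G : MixedGraph V) (U : Set V) :
    Graph (Option V) (MixedEdge V) :=
  (G.toGraph.deleteEdges {e | ∀ v ∈ e.ends, v ∈ U}).map fun v => if v ∈ U then none else some v

/-- Direction reduction of the first kind, to `G - e`: the edge `e` is a direction edge that belongs
to a direction-pure circuit of the rigidity matroid of `G`. -/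
def EdgeReduction {V : Type*} [Finite V] (G : MixedGraph V) (e : MixedEdge V) : Prop :=
  e.IsDir ∧ ∃ C, G.rigidityMatroid.IsCircuit C ∧ e ∈ C ∧ ∀ f ∈ C, f.IsDir

/-- Direction reduction of the second kind, to the proper induced subgraph `H = G[U]`: the multigraph
`G/H` is direction-pure and is the union of two edge-disjoint spanning trees. -/
def ContractionReduction {V : Type*} (G : MixedGraph V) (U : Set V) : Prop :=
  U.Nonempty ∧ U ≠ Set.univ ∧ (∀ e ∈ (G.contract U).edgeSet, e.IsDir) ∧
  ∃ T₁ T₂ : Set (MixedEdge V), (G.contract U).IsSpanningTree T₁ ∧ (G.contract U).IsSpanningTree T₂ ∧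
    Disjoint T₁ T₂ ∧ T₁ ∪ T₂ = (G.contract U).edgeSet

/-- `G` is direction irreducible: it has no direction reduction. -/
def DirectionIrreducible {V : Type*} [Finite V] (G : MixedGraph V) : Prop :=
  (¬ ∃ e, G.EdgeReduction e) ∧ ¬ ∃ U, G.ContractionReduction U

/-! ### Connectivity conditions -/

/-- `G` is 2-connected: it has at least three vertices, is connected, and remains connected when any
one vertex is deleted. -/
def TwoConnected {V : Type*} (G : MixedGraph V) : Prop :=
  3 ≤ Nat.card V ∧ (G.D ⊔ G.L).Connected ∧ ∀ v : V, ((G.D ⊔ G.L).induce {v}ᶜ).Connected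

/-- A subgraph of the mixed graph `G`. -/
structure Subgraph {V : Type*} (G : MixedGraph V) where
  verts : Set V
  D : SimpleGraph V
  L : SimpleGraph V
  D_le : D ≤ G.D
  L_le : L ≤ G.L
  D_verts : ∀ u v, D.Adj u v → u ∈ verts ∧ v ∈ verts
  L_verts : ∀ u v, L.Adj u v → u ∈ verts ∧ v ∈ verts

/-- `G = H₁ ∪ H₂`. -/
def IsUnion {V : Type*} (G : MixedGraph V) (H₁ H₂ : G.Subgraph) : Prop :=
  H₁.verts ∪ H₂.verts = Set.univ ∧ H₁.D ⊔ H₂.D = G.D ∧ H₁.L ⊔ H₂.L = G.L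

/-- `G` is direction-balanced: whenever `G = H₁ ∪ H₂`, where `H₁` and `H₂` share exactly two vertices
`u` and `v` and each has a vertex that the other one lacks, both `H₁` and `H₂` contain a direction
edge of `G` distinct from `uv`. -/
def DirectionBalanced {V : Type*} (G : MixedGraph V) : Prop :=
  ∀ (H₁ H₂ : G.Subgraph) (u v : V), u ≠ v → G.IsUnion H₁ H₂ → H₁.verts ∩ H₂.verts = {u, v} →
    (H₁.verts \ H₂.verts).Nonempty → (H₂.verts \ H₁.verts).Nonempty →
    (∃ e ∈ H₁.D.edgeSet, e ≠ s(u, v)) ∧ (∃ e ∈ H₂.D.edgeSet, e ≠ s(u, v))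

end MixedGraph

/-! Write the plane as `ℂ`. An infinitesimal motion `u` at `P` satisfies one real linear equation
per edge, and the rows of the rigidity matrix are these equations. Direction edges tolerate
translations and dilations, length edges tolerate translations and rotations. All of these are
similarities `x ↦ t + z * P x`: a direction edge forces `z` to be real and a length edge forces it
to be imaginary, so edges of both kinds leave only translations.

The main tool is `GenericConfig.exists_affine_of_isMinDep`: at a generic configuration every motion
of a circuit is a similarity on its vertices. Counting gives a vertex `v` of degree three. A circuit
stays dependent wherever `v` is placed, since generic rows have maximal rank. Special positions of
`v` then show that the edges away from `v` already force relations between the neighbours of `v`.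
Each relation is an edge in the closure of those edges, so it yields a smaller circuit, and
induction on the number of edges applies.

For generic `p`, rigidity and infinitesimal rigidity agree (`InfinitesimallyRigid.frameworkRigid`,
`FrameworkRigid.infinitesimallyRigid`). By (R1) every circuit contains a length edge. If `G` is
M-connected, each edge lies in a circuit with a fixed direction edge; that circuit has both kinds of
edges, so its motions are constant. Deleting an edge of a circuit loses no constraint, so `G - e` is
rigid.

Conversely, redundant rigidity excludes coloops, so every component `K` of the matroid is a union of
circuits. Its rank is at least `2|V(K)| - 2` if it has a direction edge, and at least `2|V(K)| - 3`
otherwise. With two or more components, 2-connectedness gives each at least two vertices of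
attachment, and direction balance gives three to those without direction edges. Hence the rank of
`K` is at least `2|V(K)|` minus the number of its shared vertices. Summing over all components gives
total rank at least `2|V|`, although translations bound it by `2|V| - 2`. -/

section LinearAlgebra

/-! ### Dependence of linear functionals and their common zeros. -/

variable {ι E : Type*} [AddCommGroup E] [Module ℝ E]

/-- Duality: this lets statements about closure in the matroid be read as statements about motions.
-/
theorem mem_span_image_iff_forall_apply_eq_zero [Finite ι] (φ : ι → E →ₗ[ℝ] ℝ) (S : Set ι)
    (ψ : E →ₗ[ℝ] ℝ) :
    ψ ∈ Submodule.span ℝ (φ '' S) ↔ ∀ u, (∀ f ∈ S, φ f u = 0) → ψ u = 0 := by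
  constructor
  · intro h u hu
    induction h using Submodule.span_induction with
    | mem x hx => obtain ⟨f, hf, rfl⟩ := hx; exact hu f hf
    | zero => rfl
    | add x y _ _ hx hy => simp [hx, hy]
    | smul a x _ hx => simp [hx]
  · intro h
    rw [Set.image_eq_range]
    refine mem_span_of_iInf_ker_le_ker fun x hx => ?_
    rw [LinearMap.mem_ker]
    refine h x fun f hf => ?_
    simpa using (Submodule.mem_iInf _).1 hx ⟨f, hf⟩

theorem exists_apply_ne_zero_of_linearIndepOn_insert [Finite ι] {φ : ι → E →ₗ[ℝ] ℝ} {S : Set ι}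
    {e : ι} (he : e ∉ S) (h : LinearIndepOn ℝ φ (insert e S)) :
    ∃ u, (∀ f ∈ S, φ f u = 0) ∧ φ e u ≠ 0 := by
  have := ((linearIndepOn_insert he).1 h).2
  rw [mem_span_image_iff_forall_apply_eq_zero] at this
  push Not at this
  exact this

theorem apply_eq_zero_of_not_linearIndepOn_insert [Finite ι] {φ : ι → E →ₗ[ℝ] ℝ} {S : Set ι} {e : ι}
    (hS : LinearIndepOn ℝ φ S) (h : ¬ LinearIndepOn ℝ φ (insert e S)) {u : E}
    (hu : ∀ f ∈ S, φ f u = 0) : φ e u = 0 := by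
  by_contra hne
  refine h (hS.insert fun hmem => hne ?_)
  exact (mem_span_image_iff_forall_apply_eq_zero φ S _).1 hmem u hu

/-- A minimal linearly dependent index set. -/
def IsMinDep (φ : ι → E →ₗ[ℝ] ℝ) (C : Set ι) : Prop :=
  Minimal (fun S => ¬ LinearIndepOn ℝ φ S) C

theorem IsMinDep.indep_of_ssubset {φ : ι → E →ₗ[ℝ] ℝ} {C S : Set ι} (hC : IsMinDep φ C)
    (h : S ⊂ C) : LinearIndepOn ℝ φ S := by
  by_contra hS
  exact h.2 (hC.2 hS h.1)

theorem IsMinDep.indep_sdiff {φ : ι → E →ₗ[ℝ] ℝ} {C : Set ι} (hC : IsMinDep φ C) {e : ι}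
    (he : e ∈ C) : LinearIndepOn ℝ φ (C \ {e}) :=
  hC.indep_of_ssubset ⟨Set.sdiff_subset, fun h => (h he).2 rfl⟩

theorem IsMinDep.apply_eq_zero [Finite ι] {φ : ι → E →ₗ[ℝ] ℝ} {C : Set ι} (hC : IsMinDep φ C)
    {e : ι} (he : e ∈ C) {u : E} (hu : ∀ f ∈ C, f ≠ e → φ f u = 0) : φ e u = 0 := by
  refine apply_eq_zero_of_not_linearIndepOn_insert (hC.indep_sdiff he) ?_ (fun f hf => hu f hf.1 hf.2)
  rw [Set.insert_sdiff_singleton, Set.insert_eq_of_mem he]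
  exact hC.1

theorem IsMinDep.nonempty {φ : ι → E →ₗ[ℝ] ℝ} {C : Set ι} (hC : IsMinDep φ C) : C.Nonempty := by
  rw [Set.nonempty_iff_ne_empty]
  rintro rfl
  exact hC.1 (linearIndepOn_empty _ _)

/-- A minimal `T ⊆ S` that still forces `φ e u = 0` gives the circuit `insert e T`: by minimality,
for each `x ∈ T` some `u` vanishes on the rest of `T` but not at `e`, and this makes every proper
subset independent. -/
theorem exists_isMinDep_of_forall_apply_eq_zero [Finite ι] (φ : ι → E →ₗ[ℝ] ℝ) {S : Set ι} {e : ι}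
    (he : e ∉ S) (h : ∀ u, (∀ f ∈ S, φ f u = 0) → φ e u = 0) :
    ∃ C, IsMinDep φ C ∧ e ∈ C ∧ C ⊆ insert e S := by
  obtain ⟨T, hTS, hT⟩ := (Set.toFinite {T : Set ι | ∀ u, (∀ f ∈ T, φ f u = 0) → φ e u = 0}).exists_le_minimal h
  have heT : e ∉ T := fun h => he (hTS h)
  have hTe : ∀ x ∈ T, ∃ u, (∀ f ∈ T \ {x}, φ f u = 0) ∧ φ e u ≠ 0 := by
    intro x hx
    by_contra! hcon
    exact (hT.2 (y := T \ {x}) hcon Set.sdiff_subset hx).2 rfl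
  have hTx : ∀ x ∈ T, ¬ ∀ u, (∀ f ∈ T \ {x}, φ f u = 0) → φ x u = 0 := by
    intro x hx hcon
    obtain ⟨u, hu, hne⟩ := hTe x hx
    refine hne (hT.1 u fun f hf => ?_)
    by_cases hfx : f = x
    · exact hfx ▸ hcon u hu
    · exact hu f ⟨hf, hfx⟩
  have hind : ∀ R ⊆ T, LinearIndepOn ℝ φ R := by
    intro R
    induction R, Set.toFinite R using Set.Finite.induction_on with
    | empty => intro _; exact linearIndepOn_empty _ _
    | @insert a R ha _ ih =>
      intro hR
      refine (ih ((Set.subset_insert _ _).trans hR)).insert fun hmem => ?_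
      rw [mem_span_image_iff_forall_apply_eq_zero] at hmem
      refine hTx a (hR (Set.mem_insert _ _)) fun u hu => hmem u fun f hf => hu f ⟨?_, ?_⟩
      · exact hR (Set.mem_insert_of_mem _ hf)
      · rintro rfl; exact ha hf
  refine ⟨insert e T, ⟨?_, ?_⟩, Set.mem_insert _ _, Set.insert_subset_insert hTS⟩
  · intro hcon
    obtain ⟨u, hu, hne⟩ := exists_apply_ne_zero_of_linearIndepOn_insert heT hcon
    exact hne (hT.1 u hu)
  · intro R hR hRT
    by_contra hnle
    obtain ⟨x, hx, hxR⟩ := Set.not_subset.1 hnle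
    refine hR ?_
    rcases hx with rfl | hxT
    · exact hind R fun y hy => (hRT hy).resolve_left fun h => hxR (h ▸ hy)
    · have hsub : R ⊆ insert e (T \ {x}) := by
        intro y hy
        rcases hRT hy with h | h
        · exact Or.inl h
        · exact Or.inr ⟨h, fun h' => hxR (h' ▸ hy)⟩
      refine LinearIndepOn.mono ?_ hsub
      refine (hind _ Set.sdiff_subset).insert fun hmem => ?_
      rw [mem_span_image_iff_forall_apply_eq_zero] at hmem
      obtain ⟨u, hu, hne⟩ := hTe x hxT
      exact hne (hmem u hu)

end LinearAlgebra

/-! ### The rigidity matrix in complex notation. -/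

namespace MixedEdge

variable {V : Type*}

/-- The unit complex number by which the edge vector is multiplied in the rigidity matrix. -/
noncomputable def unit (e : MixedEdge V) : ℂ := Sum.elim (fun _ => -Complex.I) (fun _ => 1) e

theorem unit_inl (s : Sym2 V) : unit (Sum.inl s : MixedEdge V) = -Complex.I := rfl

theorem unit_inr (s : Sym2 V) : unit (Sum.inr s : MixedEdge V) = 1 := rfl

theorem ext_unit_ends {e f : MixedEdge V} (h₁ : e.unit = f.unit) (h₂ : e.ends = f.ends) : e = f := by
  rcases e with s | s <;> rcases f with t | t <;>
    simp_all [ends, unit, Complex.ext_iff]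

theorem unit_ne_zero (e : MixedEdge V) : e.unit ≠ 0 := by
  rcases e with s | s <;> simp [unit]

/-- The linear constraint that an edge imposes on an infinitesimal motion `u` at `P`. -/
noncomputable def constraint (P : V → ℂ) (e : MixedEdge V) : (V → ℂ) →ₗ[ℝ] ℝ where
  toFun u := e.ends.lift ⟨fun a b => (e.unit * (P a - P b) * (starRingEnd ℂ) (u a - u b)).re,
    fun a b => by
      dsimp only; rw [← neg_sub (P b), ← neg_sub (u b), map_neg]; ring_nf⟩
  map_add' u v := by
    induction e.ends with | _ a b
    simp; ring
  map_smul' r u := by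
    induction e.ends with | _ a b
    simp; ring

theorem constraint_apply {P u : V → ℂ} {e : MixedEdge V} {a b : V} (h : e.ends = s(a, b)) :
    constraint P e u = (e.unit * (P a - P b) * (starRingEnd ℂ) (u a - u b)).re := by
  simp only [constraint, LinearMap.coe_mk, AddHom.coe_mk, h, Sym2.lift_mk]

end MixedEdge

/-- A point of the plane as a complex number. -/
noncomputable def toComplex (x : Plane) : ℂ := Complex.orthonormalBasisOneI.repr.symm x

theorem toComplex_eq (x : Plane) : toComplex x = ⟨x 0, x 1⟩ := by
  apply Complex.ext <;> simp [toComplex]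

namespace MixedEdge

variable {V : Type*}

/-- A vector of coefficients of the rigidity matrix as a linear functional. -/
noncomputable def rowFunctional [Fintype V] : (V × Fin 2 → ℝ) →ₗ[ℝ] ((V → ℂ) →ₗ[ℝ] ℝ) where
  toFun r :=
    { toFun := fun u => ∑ v, (r (v, 0) * (u v).re + r (v, 1) * (u v).im)
      map_add' := fun u v => by
        rw [← Finset.sum_add_distrib]; congr; ext; simp; ring
      map_smul' := fun c u => by
        simp only [RingHom.id_apply, smul_eq_mul, Finset.mul_sum]; congr; ext; simp; ring }
  map_add' r s := by
    ext u
    simp only [LinearMap.coe_mk, AddHom.coe_mk, LinearMap.add_apply, ← Finset.sum_add_distrib]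
    congr; ext; simp; ring
  map_smul' c r := by
    ext u
    simp only [LinearMap.coe_mk, AddHom.coe_mk, LinearMap.smul_apply, RingHom.id_apply, smul_eq_mul,
      Finset.mul_sum]
    congr; ext; simp; ring

theorem rowFunctional_apply [Fintype V] (r : V × Fin 2 → ℝ) (u : V → ℂ) :
    rowFunctional r u = ∑ v, (r (v, 0) * (u v).re + r (v, 1) * (u v).im) := rfl

theorem rowFunctional_injective [Fintype V] :
    Function.Injective (rowFunctional : (V × Fin 2 → ℝ) →ₗ[ℝ] ((V → ℂ) →ₗ[ℝ] ℝ)) := by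
  classical
  rw [injective_iff_map_eq_zero]
  intro r hr
  funext ⟨v, i⟩
  fin_cases i
  · simpa [rowFunctional_apply, Pi.single_apply, apply_ite] using
      LinearMap.congr_fun hr (Pi.single v 1)
  · simpa [rowFunctional_apply, Pi.single_apply, apply_ite] using
      LinearMap.congr_fun hr (Pi.single v Complex.I)

theorem rowFunctional_row [Fintype V] (p : V → Plane) (e : MixedEdge V) :
    rowFunctional (row p e) = constraint (toComplex ∘ p) e := by
  classical
  refine LinearMap.ext fun u => ?_
  rcases e with s | s
  · induction s with | _ a b
    rw [constraint_apply (a := a) (b := b) rfl, rowFunctional_apply]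
    simp [row, toComplex_eq, add_mul, ite_mul, Finset.sum_add_distrib, unit_inl]
    ring
  · induction s with | _ a b
    rw [constraint_apply (a := a) (b := b) rfl, rowFunctional_apply]
    simp [row, toComplex_eq, add_mul, ite_mul, Finset.sum_add_distrib, unit_inr]
    ring

theorem linearIndepOn_row_iff [Finite V] (p : V → Plane) (S : Set (MixedEdge V)) :
    LinearIndepOn ℝ (row p) S ↔ LinearIndepOn ℝ (constraint (toComplex ∘ p)) S := by
  have := Fintype.ofFinite V
  rw [show constraint (toComplex ∘ p) = rowFunctional ∘ row p from
    funext fun e => (rowFunctional_row p e).symm]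
  exact (LinearMap.linearIndepOn_iff_of_injOn _ rowFunctional_injective.injOn).symm

end MixedEdge

/-! ### Genericity and maximal rank. -/

theorem exists_aeval_eq_row {V : Type*} (e : MixedEdge V) (x : V × Fin 2) :
    ∃ Q : MvPolynomial (V × Fin 2) ℚ, ∀ p : V → Plane,
      MvPolynomial.aeval (fun y : V × Fin 2 => p y.1 y.2) Q = MixedEdge.row p e x := by
  classical
  obtain ⟨v, i⟩ := x
  open MvPolynomial in
  rcases e with s | s
  · induction s with | _ a b
    refine ⟨(if v = a then ![X (a, 1) - X (b, 1), -(X (a, 0) - X (b, 0))] i else 0) +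
      (if v = b then ![X (b, 1) - X (a, 1), -(X (b, 0) - X (a, 0))] i else 0), fun p => ?_⟩
    simp only [MixedEdge.row, Sym2.lift_mk]
    fin_cases i <;> split_ifs <;> simp
  · induction s with | _ a b
    refine ⟨(if v = a then X (a, i) - X (b, i) else 0) +
      (if v = b then X (b, i) - X (a, i) else 0), fun p => ?_⟩
    simp only [MixedEdge.row, Sym2.lift_mk]
    split_ifs <;> simp

/-- The Gram determinant expresses independence of rows as the non-vanishing of a single polynomial
in the coordinates, which is what genericity can handle. -/
theorem linearIndependent_iff_det_ne_zero {ι κ : Type*} [Fintype ι] [DecidableEq ι] [Fintype κ]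
    (w : ι → κ → ℝ) :
    LinearIndependent ℝ w ↔ (Matrix.of fun i j => ∑ x, w i x * w j x).det ≠ 0 := by
  have h := Matrix.det_gram_ne_zero_iff_linearIndependent (𝕜 := ℝ)
    (v := fun i => (WithLp.toLp 2 (w i) : EuclideanSpace ℝ κ))
  rw [← (WithLp.linearEquiv 2 ℝ (κ → ℝ)).symm.toLinearMap.linearIndependent_iff_of_injOn
    (WithLp.linearEquiv 2 ℝ (κ → ℝ)).symm.injective.injOn]
  refine h.symm.trans ?_
  have : (Matrix.gram ℝ fun i => (WithLp.toLp 2 (w i) : EuclideanSpace ℝ κ)) =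
      Matrix.of fun i j => ∑ x, w i x * w j x := by
    ext i j
    simp [Matrix.gram_apply, PiLp.inner_apply, mul_comm]
  rw [this]

namespace IsGeneric

variable {V : Type*} {p : V → Plane}

theorem aeval_ne_zero (hp : IsGeneric p) {Q : MvPolynomial (V × Fin 2) ℚ}
    (q : V → Plane) (h : MvPolynomial.aeval (fun y : V × Fin 2 => q y.1 y.2) Q ≠ 0) :
    MvPolynomial.aeval (fun y : V × Fin 2 => p y.1 y.2) Q ≠ 0 := by
  intro h0
  apply h
  have : Q = 0 := hp (by rw [h0, map_zero])
  rw [this, map_zero]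

/-- The Gram determinant of the rows in `S` is a rational polynomial in the coordinates. As it is
nonzero at `q`, it is not the zero polynomial, so it is nonzero at a generic point. -/
theorem linearIndepOn_row [Finite V] (hp : IsGeneric p) {q : V → Plane} {S : Set (MixedEdge V)}
    (h : LinearIndepOn ℝ (MixedEdge.row q) S) : LinearIndepOn ℝ (MixedEdge.row p) S := by
  classical
  have := Fintype.ofFinite V
  have := Fintype.ofFinite S
  choose Q hQ using @exists_aeval_eq_row V
  have key : ∀ r : V → Plane, MvPolynomial.aeval (fun y : V × Fin 2 => r y.1 y.2)
      (Matrix.of fun i j : S => ∑ x, Q i x * Q j x).det =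
      (Matrix.of fun i j : S => ∑ x, MixedEdge.row r i x * MixedEdge.row r j x).det := by
    intro r
    rw [AlgHom.map_det]
    congr 1
    ext i j
    simp [hQ]
  unfold LinearIndepOn at h ⊢
  rw [linearIndependent_iff_det_ne_zero] at h ⊢
  rw [← key] at h ⊢
  exact hp.aeval_ne_zero q h

theorem linearIndepOn_constraint [Finite V] (hp : IsGeneric p) {Q : V → ℂ} {S : Set (MixedEdge V)}
    (h : LinearIndepOn ℝ (MixedEdge.constraint Q) S) :
    LinearIndepOn ℝ (MixedEdge.constraint (toComplex ∘ p)) S := by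
  have hQ : Q = toComplex ∘ (fun v => Complex.orthonormalBasisOneI.repr (Q v)) := by
    funext v; simp [toComplex]
  rw [hQ, ← MixedEdge.linearIndepOn_row_iff] at h
  exact (MixedEdge.linearIndepOn_row_iff _ _).1 (hp.linearIndepOn_row h)

theorem re_mul_conj_ne_zero (hp : IsGeneric p) {v a b : V} (ha : v ≠ a) (hb : v ≠ b) :
    ((toComplex (p v) - toComplex (p a)) *
      (starRingEnd ℂ) (toComplex (p v) - toComplex (p b))).re ≠ 0 := by
  classical
  open MvPolynomial in
  have := hp.aeval_ne_zero (Q := (X (v, 0) - X (a, 0)) * (X (v, 0) - X (b, 0)) +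
    (X (v, 1) - X (a, 1)) * (X (v, 1) - X (b, 1)))
    -- With `v` at `(1, 0)` and all other points at the origin the polynomial equals `1`.
    (fun x => WithLp.toLp 2 fun i => if x = v ∧ i = 0 then 1 else 0) (by simp [ha.symm, hb.symm])
  simp [toComplex_eq] at this ⊢
  intro h
  apply this
  linarith

theorem im_mul_conj_ne_zero (hp : IsGeneric p) {v a b : V} (ha : v ≠ a) (hb : v ≠ b) (hab : a ≠ b) :
    ((toComplex (p v) - toComplex (p a)) *
      (starRingEnd ℂ) (toComplex (p v) - toComplex (p b))).im ≠ 0 := by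
  classical
  open MvPolynomial in
  have := hp.aeval_ne_zero (Q := (X (v, 1) - X (a, 1)) * (X (v, 0) - X (b, 0)) -
    (X (v, 0) - X (a, 0)) * (X (v, 1) - X (b, 1)))
    -- With `v` at `(0, 1)`, `b` at `(1, 0)` and all other points at the origin the polynomial
    -- equals `-1`.
    (fun x => WithLp.toLp 2 fun i => if (x = v ∧ i = 1) ∨ (x = b ∧ i = 0) then 1 else 0)
      (by simp [ha.symm, hb, hb.symm, hab])
  simp [toComplex_eq] at this ⊢
  intro h
  apply this
  linarith

end IsGeneric

open MixedEdge ComplexConjugate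

/-- The properties of a generic configuration of points that the rigidity matroid depends on. -/
structure GenericConfig {V : Type*} (P : V → ℂ) : Prop where
  indep : ∀ (Q : V → ℂ) (S : Set (MixedEdge V)), LinearIndepOn ℝ (constraint Q) S →
    LinearIndepOn ℝ (constraint P) S
  re_ne : ∀ {v a b : V}, v ≠ a → v ≠ b → ((P v - P a) * conj (P v - P b)).re ≠ 0
  im_ne : ∀ {v a b : V}, v ≠ a → v ≠ b → a ≠ b → ((P v - P a) * conj (P v - P b)).im ≠ 0

theorem IsGeneric.genericConfig {V : Type*} [Finite V] {p : V → Plane} (hp : IsGeneric p) :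
    GenericConfig (toComplex ∘ p) where
  indep _ _ h := hp.linearIndepOn_constraint h
  re_ne := hp.re_mul_conj_ne_zero
  im_ne := hp.im_mul_conj_ne_zero

/-! ### Edge counts and vertex degrees of circuits. -/

namespace MixedEdge

variable {V : Type*}

/-- The set of end vertices of a set of edges. -/
def verts (S : Set (MixedEdge V)) : Set V := {x | ∃ e ∈ S, x ∈ e.ends}

theorem mem_verts_left {S : Set (MixedEdge V)} {e : MixedEdge V} (he : e ∈ S) {a b : V}
    (h : e.ends = s(a, b)) : a ∈ verts S := ⟨e, he, h ▸ Sym2.mem_mk_left a b⟩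

theorem mem_verts_right {S : Set (MixedEdge V)} {e : MixedEdge V} (he : e ∈ S) {a b : V}
    (h : e.ends = s(a, b)) : b ∈ verts S := ⟨e, he, h ▸ Sym2.mem_mk_right a b⟩

theorem verts_mono {S T : Set (MixedEdge V)} (h : S ⊆ T) : verts S ⊆ verts T :=
  fun _ ⟨e, he, hx⟩ => ⟨e, h he, hx⟩

theorem exists_ends_eq (e : MixedEdge V) : ∃ a b, e.ends = s(a, b) := by
  induction h : e.ends with | _ a b
  exact ⟨a, b, rfl⟩

theorem unit_eq_or (e : MixedEdge V) : e.unit = 1 ∨ e.unit = -Complex.I := by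
  rcases e with s | s
  · exact Or.inr rfl
  · exact Or.inl rfl

/-- A vector that is supported on `Y`, given by its values there. -/
noncomputable def extendZero (Y : Set V) : (Y → ℂ) →ₗ[ℝ] (V → ℂ) where
  toFun w v := by classical exact if h : v ∈ Y then w ⟨v, h⟩ else 0
  map_add' w z := by
    funext v
    by_cases h : v ∈ Y <;> simp [h]
  map_smul' r w := by
    funext v
    by_cases h : v ∈ Y <;> simp [h]

theorem extendZero_of_mem {Y : Set V} (w : Y → ℂ) {v : V} (h : v ∈ Y) :
    extendZero Y w v = w ⟨v, h⟩ := by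
  simp [extendZero, h]

theorem extendZero_of_notMem {Y : Set V} (w : Y → ℂ) {v : V} (h : v ∉ Y) :
    extendZero Y w v = 0 := by
  simp [extendZero, h]

theorem constraint_congr {P Q u w : V → ℂ} {e : MixedEdge V}
    (h : ∀ x ∈ e.ends, ∀ y ∈ e.ends, P x - P y = Q x - Q y ∧ u x - u y = w x - w y) :
    constraint P e u = constraint Q e w := by
  obtain ⟨a, b, hab⟩ := exists_ends_eq e
  have := h a (hab ▸ Sym2.mem_mk_left a b) b (hab ▸ Sym2.mem_mk_right a b)
  rw [constraint_apply hab, constraint_apply hab, this.1, this.2]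

/-- An independent set of edges on a vertex set `X` has at most `2|X| - 2` elements. -/
theorem ncard_add_two_le [Finite V] {P : V → ℂ} {S : Set (MixedEdge V)}
    (hS : LinearIndepOn ℝ (constraint P) S) {X : Set V} (hX : X.Nonempty)
    (hSX : verts S ⊆ X) : S.ncard + 2 ≤ 2 * X.ncard := by
  obtain ⟨x₀, hx₀⟩ := hX
  -- Constraints in `S` are invariant under translation and see only vertices of `X`. So they are
  -- determined by their values on vectors supported on `X` minus one point, a space of dimension
  -- `2|X| - 2`.
  set Y := X \ {x₀} with hY
  let ψ : ((V → ℂ) →ₗ[ℝ] ℝ) →ₗ[ℝ] ((Y → ℂ) →ₗ[ℝ] ℝ) := (extendZero Y).dualMap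
  have hext : ∀ χ ∈ Submodule.span ℝ (constraint P '' S), ∀ u : V → ℂ,
      χ (extendZero Y fun y => u y - u x₀) = χ u := by
    intro χ hχ u
    induction hχ using Submodule.span_induction with
    | mem x hx =>
      obtain ⟨e, he, rfl⟩ := hx
      have hval : ∀ x ∈ e.ends, extendZero Y (fun y : Y => u y - u x₀) x = u x - u x₀ := by
        intro x hx
        by_cases hxx : x = x₀
        · subst hxx
          rw [extendZero_of_notMem _ (by simp [hY]), sub_self]
        · rw [extendZero_of_mem _ (show x ∈ Y from ⟨hSX ⟨e, he, hx⟩, hxx⟩)]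
      refine constraint_congr fun x hx y hy => ⟨rfl, ?_⟩
      rw [hval x hx, hval y hy, sub_sub_sub_cancel_right]
    | zero => rfl
    | add x y _ _ hx hy => simp only [LinearMap.add_apply, hx, hy]
    | smul a x _ hx => simp only [LinearMap.smul_apply, hx]
  have hinj : Set.InjOn ψ (Submodule.span ℝ (constraint P '' S)) := by
    intro χ₁ h₁ χ₂ h₂ h
    refine LinearMap.ext fun u => ?_
    rw [← hext χ₁ h₁, ← hext χ₂ h₂]
    exact LinearMap.congr_fun h _
  have hind : LinearIndepOn ℝ (ψ ∘ constraint P) S :=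
    (LinearMap.linearIndepOn_iff_of_injOn ψ hinj).2 hS
  have := Fintype.ofFinite V
  have := Fintype.ofFinite S
  have := Fintype.ofFinite Y
  have h := LinearIndependent.fintype_card_le_finrank hind
  have hfr : Module.finrank ℝ ((Y → ℂ) →ₗ[ℝ] ℝ) = 2 * Fintype.card Y := by
    rw [show Module.finrank ℝ ((Y → ℂ) →ₗ[ℝ] ℝ) = Module.finrank ℝ (Y → ℂ) from
      Subspace.dual_finrank_eq, Module.finrank_pi_fintype]
    simp [mul_comm]
  rw [hfr, ← Nat.card_eq_fintype_card, ← Nat.card_eq_fintype_card, Nat.card_coe_set_eq,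
    Nat.card_coe_set_eq] at h
  have := Set.ncard_sdiff_singleton_add_one hx₀ (Set.toFinite X)
  rw [← hY] at this
  omega

theorem sum_degree [Fintype V] (C : Finset (MixedEdge V)) (hC : ∀ e ∈ C, ¬ e.ends.IsDiag)
    (X : Finset V) (hX : verts (C : Set (MixedEdge V)) ⊆ X) [DecidableEq V] :
    ∑ v ∈ X, (C.filter fun e => v ∈ e.ends).card = 2 * C.card := by
  have h := Finset.sum_card_bipartiteAbove_eq_sum_card_bipartiteBelow
    (s := X) (t := C) (fun v e => v ∈ e.ends)
  unfold Finset.bipartiteAbove Finset.bipartiteBelow at h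
  rw [h, Finset.sum_congr rfl (g := fun _ => 2), Finset.sum_const, smul_eq_mul, mul_comm]
  intro e he
  obtain ⟨a, b, hab⟩ := exists_ends_eq e
  have hne : a ≠ b := by
    have := hC e he
    rwa [hab, Sym2.mk_isDiag_iff] at this
  rw [show X.filter (fun v => v ∈ e.ends) = {a, b} from ?_, Finset.card_pair hne]
  ext x
  simp only [Finset.mem_filter, hab, Sym2.mem_iff, Finset.mem_insert, Finset.mem_singleton,
    and_iff_right_iff_imp]
  rintro (rfl | rfl)
  · exact hX (mem_verts_left he hab)
  · exact hX (mem_verts_right he hab)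

end MixedEdge

namespace GenericConfig

variable {V : Type*} {P : V → ℂ}

theorem injective (hP : GenericConfig P) : Function.Injective P := by
  intro a b hab
  by_contra hne
  exact hP.re_ne hne hne (by simp [hab])

/-- The coefficients at `v` of two different edges are linearly independent. -/
theorem im_unit_mul_ne (hP : GenericConfig P) {v a b : V} {e f : MixedEdge V} (hef : e ≠ f)
    (he : e.ends = s(v, a)) (hf : f.ends = s(v, b)) (ha : v ≠ a) (hb : v ≠ b) :
    ((e.unit * (P v - P a)) * conj (f.unit * (P v - P b))).im ≠ 0 := by
  have hre := hP.re_ne ha hb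
  have him := hP.im_ne ha hb
  have hsame : e.unit = f.unit → a ≠ b := by
    rintro h rfl
    exact hef (ext_unit_ends h (he.trans hf.symm))
  set X := P v - P a
  set Y := P v - P b
  -- Edges of the same kind are non-parallel because `v`, `a`, `b` are not collinear. Edges of
  -- different kinds differ by a factor `±I`, which turns the question into `X` and `Y` not being
  -- orthogonal; here `a = b` is allowed.
  rw [show (e.unit * X) * conj (f.unit * Y) = (e.unit * conj f.unit) * (X * conj Y) by
    rw [map_mul]; ring]
  rcases unit_eq_or e with h1 | h1 <;> rcases unit_eq_or f with h2 | h2 <;> 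
    rw [h1, h2] at hsame ⊢
  · simpa using him (hsame rfl)
  · simpa using hre
  · rw [map_one, mul_one, neg_mul, Complex.neg_im, Complex.I_mul_im]
    exact neg_ne_zero.2 hre
  · simpa using him (hsame rfl)

/-- With at most two edges at `v`, one can move `v` alone so that one of them is violated and the
other is not. A circuit admits no vector that violates exactly one of its edges. -/
theorem three_le_degree [Finite V] (hP : GenericConfig P) {C : Set (MixedEdge V)}
    (hC : IsMinDep (constraint P) C) (hdiag : ∀ e ∈ C, ¬ e.ends.IsDiag) {v : V}
    (hv : v ∈ verts C) : 3 ≤ {e ∈ C | v ∈ e.ends}.ncard := by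
  classical
  by_contra! hlt
  obtain ⟨e, heC, hve⟩ := hv
  obtain ⟨a, ha⟩ := hve
  have hva : v ≠ a := by have := hdiag e heC; rwa [ha, Sym2.mk_isDiag_iff] at this
  obtain ⟨y, hy, hy'⟩ : ∃ y : ℂ, (e.unit * (P v - P a) * conj y).re ≠ 0 ∧
      ∀ f ∈ C, f ≠ e → ∀ b, f.ends = s(v, b) → (f.unit * (P v - P b) * conj y).re = 0 := by
    by_cases h : ∃ f ∈ C, v ∈ f.ends ∧ f ≠ e
    · obtain ⟨f, hfC, ⟨b, hb⟩, hfe⟩ := h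
      have hvb : v ≠ b := by have := hdiag f hfC; rwa [hb, Sym2.mk_isDiag_iff] at this
      -- A vector orthogonal to the coefficient of `f` at `v`; it is not orthogonal to that of `e`,
      -- as the two coefficients are independent.
      refine ⟨Complex.I * (f.unit * (P v - P b)), ?_, ?_⟩
      · have := hP.im_unit_mul_ne hfe.symm ha hb hva hvb
        rw [map_mul, Complex.conj_I, show e.unit * (P v - P a) *
          (-Complex.I * conj (f.unit * (P v - P b))) =
          -(Complex.I * (e.unit * (P v - P a) * conj (f.unit * (P v - P b)))) by ring]
        simpa only [Complex.neg_re, Complex.I_mul_re, neg_neg] using this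
      · intro g hgC hge c hc
        have hgf : g = f := by
          by_contra hgf
          have h3 : ({e, f, g} : Set (MixedEdge V)) ⊆ {e ∈ C | v ∈ e.ends} := by
            rintro x (rfl | rfl | rfl)
            · exact ⟨heC, a, ha⟩
            · exact ⟨hfC, b, hb⟩
            · exact ⟨hgC, c, hc⟩
          have := Set.ncard_le_ncard h3 (Set.toFinite _)
          rw [Set.ncard_eq_three.2 ⟨e, f, g, hfe.symm, hge.symm, Ne.symm hgf, rfl⟩] at this
          omega
        subst hgf
        have hcb : c = b := by
          have := hc.symm.trans hb
          exact Sym2.congr_right.1 this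
        subst hcb
        rw [map_mul, Complex.conj_I, show g.unit * (P v - P c) *
          (-Complex.I * conj (g.unit * (P v - P c))) =
          -(Complex.I * (g.unit * (P v - P c) * conj (g.unit * (P v - P c)))) by ring,
          Complex.mul_conj]
        simp
    · push Not at h
      refine ⟨e.unit * (P v - P a), ?_, fun f hf hfe b hb => absurd (h f hf ⟨b, hb⟩) hfe⟩
      rw [Complex.mul_conj, Complex.ofReal_re]
      exact (Complex.normSq_pos.2 (mul_ne_zero (unit_ne_zero e)
        (sub_ne_zero.2 (hP.injective.ne hva)))).ne'
  refine hy ?_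
  have := hC.apply_eq_zero heC (u := Pi.single v y) ?_
  · rwa [constraint_apply ha, Pi.single_eq_same, Pi.single_eq_of_ne hva.symm, sub_zero] at this
  · intro f hfC hfe
    by_cases hvf : v ∈ f.ends
    · obtain ⟨b, hb⟩ := hvf
      have hvb : v ≠ b := by have := hdiag f hfC; rwa [hb, Sym2.mk_isDiag_iff] at this
      rw [constraint_apply hb, Pi.single_eq_same, Pi.single_eq_of_ne hvb.symm, sub_zero]
      exact hy' f hfC hfe b hb
    · rw [constraint_congr (Q := P) (w := 0), map_zero]
      intro x hx z hz
      have h1 : x ≠ v := fun h => hvf (h ▸ hx)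
      have h2 : z ≠ v := fun h => hvf (h ▸ hz)
      simp [Pi.single_eq_of_ne h1, Pi.single_eq_of_ne h2]

/-- Every circuit has a vertex of degree three. -/
theorem exists_degree_eq_three [Finite V] (hP : GenericConfig P) {C : Set (MixedEdge V)}
    (hC : IsMinDep (constraint P) C) (hdiag : ∀ e ∈ C, ¬ e.ends.IsDiag) :
    ∃ v, {e ∈ C | v ∈ e.ends}.ncard = 3 := by
  classical
  have := Fintype.ofFinite V
  obtain ⟨e, he⟩ := hC.nonempty
  obtain ⟨a, b, hab⟩ := exists_ends_eq e
  have hne : (verts C).Nonempty := ⟨a, mem_verts_left he hab⟩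
  have h1 := ncard_add_two_le (hC.indep_sdiff he) hne (verts_mono Set.sdiff_subset)
  have h2 := Set.ncard_sdiff_singleton_add_one he (Set.toFinite C)
  have h3 := sum_degree C.toFinite.toFinset (by simpa using hdiag) (verts C).toFinite.toFinset
    (by simp)
  rw [← Set.ncard_eq_toFinset_card C] at h3
  by_contra! hcon
  -- If no degree were three, all would be at least four, so `4|V(C)| ≤ 2|C|`; but `|C| ≤ 2|V(C)| -
  -- 1`.
  have h4 : ∑ v ∈ (verts C).toFinite.toFinset, 4 ≤
      ∑ v ∈ (verts C).toFinite.toFinset, (C.toFinite.toFinset.filter fun e => v ∈ e.ends).card := by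
    refine Finset.sum_le_sum fun v hv => ?_
    have h5 := hP.three_le_degree hC hdiag (by simpa using hv)
    have h6 := hcon v
    have h7 : {e ∈ C | v ∈ e.ends}.ncard =
        (C.toFinite.toFinset.filter fun e => v ∈ e.ends).card := by
      rw [← Set.ncard_coe_finset]
      congr 1
      ext; simp
    omega
  rw [Finset.sum_const, smul_eq_mul, ← Set.ncard_eq_toFinset_card (verts C)] at h4
  omega

end GenericConfig

/-! ### Moving a trivalent vertex of a circuit to a special position. -/

/-- The edges of `C` at `v` are the three edges `e₁ = va₁`, `e₂ = va₂` and `e₃ = va₃`. -/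
structure IsTrivalentAt {V : Type*} (C : Set (MixedEdge V)) (v : V) (e₁ e₂ e₃ : MixedEdge V)
    (a₁ a₂ a₃ : V) : Prop where
  ne₁₂ : e₁ ≠ e₂
  ne₁₃ : e₁ ≠ e₃
  ne₂₃ : e₂ ≠ e₃
  mem₁ : e₁ ∈ C
  mem₂ : e₂ ∈ C
  mem₃ : e₃ ∈ C
  ends₁ : e₁.ends = s(v, a₁)
  ends₂ : e₂.ends = s(v, a₂)
  ends₃ : e₃.ends = s(v, a₃)
  vne₁ : v ≠ a₁
  vne₂ : v ≠ a₂
  vne₃ : v ≠ a₃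
  eq_or : ∀ f ∈ C, v ∈ f.ends → f = e₁ ∨ f = e₂ ∨ f = e₃

namespace IsTrivalentAt

variable {V : Type*} {P : V → ℂ} {C : Set (MixedEdge V)} {v : V} {e₁ e₂ e₃ : MixedEdge V}
  {a₁ a₂ a₃ : V}

theorem swap (T : IsTrivalentAt C v e₁ e₂ e₃ a₁ a₂ a₃) :
    IsTrivalentAt C v e₂ e₁ e₃ a₂ a₁ a₃ :=
  ⟨T.ne₁₂.symm, T.ne₂₃, T.ne₁₃, T.mem₂, T.mem₁, T.mem₃, T.ends₂, T.ends₁, T.ends₃, T.vne₂, T.vne₁,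
    T.vne₃, fun f hf hv => by have := T.eq_or f hf hv; tauto⟩

theorem rotate (T : IsTrivalentAt C v e₁ e₂ e₃ a₁ a₂ a₃) :
    IsTrivalentAt C v e₂ e₃ e₁ a₂ a₃ a₁ :=
  ⟨T.ne₂₃, T.ne₁₂.symm, T.ne₁₃.symm, T.mem₂, T.mem₃, T.mem₁, T.ends₂, T.ends₃, T.ends₁, T.vne₂,
    T.vne₃, T.vne₁, fun f hf hv => by have := T.eq_or f hf hv; tauto⟩

/-- If `C` is a circuit at a generic position, then it is dependent when `v` is moved to `w`. The
coefficients of a dependency at the edges at `v` satisfy the following equations. -/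
theorem exists_stress [Finite V] (T : IsTrivalentAt C v e₁ e₂ e₃ a₁ a₂ a₃) (hP : GenericConfig P)
    (hC : IsMinDep (constraint P) C) (w : ℂ) :
    ∃ l₁ l₂ l₃ : ℝ, ¬ (l₁ = 0 ∧ l₂ = 0 ∧ l₃ = 0) ∧
      l₁ * (e₁.unit * (w - P a₁)) + l₂ * (e₂.unit * (w - P a₂)) +
        l₃ * (e₃.unit * (w - P a₃)) = 0 ∧
      ∀ u : V → ℂ, (∀ f ∈ C, v ∉ f.ends → constraint P f u = 0) →
        l₁ * (e₁.unit * (w - P a₁) * conj (u a₁)).re + l₂ * (e₂.unit * (w - P a₂) * conj (u a₂)).re +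
        l₃ * (e₃.unit * (w - P a₃) * conj (u a₃)).re = 0 := by
  classical
  set Q := Function.update P v w with hQ
  have hQv : Q v = w := Function.update_self ..
  have hQa : ∀ x, v ≠ x → Q x = P x := fun x hx => Function.update_of_ne hx.symm _ _
  have hoff : ∀ f : MixedEdge V, v ∉ f.ends → ∀ u u' : V → ℂ, (∀ x, x ≠ v → u x = u' x) →
      constraint Q f u = constraint P f u' := by
    intro f hf u u' h
    refine constraint_congr fun x hx y hy => ?_
    have h1 : x ≠ v := fun h => hf (h ▸ hx)
    have h2 : y ≠ v := fun h => hf (h ▸ hy)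
    rw [hQa x h1.symm, hQa y h2.symm, h x h1, h y h2]
    exact ⟨rfl, rfl⟩
  -- Independence at the special position `Q` would carry over to the generic `P`.
  have hdep : ¬ LinearIndepOn ℝ (constraint Q) (C.toFinite.toFinset : Set (MixedEdge V)) := by
    rw [Set.Finite.coe_toFinset]
    exact fun h => hC.1 (hP.indep Q C h)
  set F := C.toFinite.toFinset with hF
  rw [linearIndepOn_finset_iff] at hdep
  push Not at hdep
  obtain ⟨g, hg, e, he, hge⟩ := hdep
  have hfilter : F.filter (fun f => v ∈ f.ends) = {e₁, e₂, e₃} := by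
    ext f
    simp only [hF, Finset.mem_filter, Set.Finite.mem_toFinset, Finset.mem_insert,
      Finset.mem_singleton]
    constructor
    · exact fun h => T.eq_or f h.1 h.2
    · rintro (rfl | rfl | rfl)
      · exact ⟨T.mem₁, a₁, T.ends₁⟩
      · exact ⟨T.mem₂, a₂, T.ends₂⟩
      · exact ⟨T.mem₃, a₃, T.ends₃⟩
  have hsplit : ∀ u : V → ℂ, (∑ f ∈ F.filter (fun f => v ∉ f.ends), g f * constraint Q f u) +
      (g e₁ * constraint Q e₁ u + (g e₂ * constraint Q e₂ u + g e₃ * constraint Q e₃ u)) = 0 := by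
    intro u
    have h := LinearMap.congr_fun hg u
    rw [LinearMap.sum_apply, ← Finset.sum_filter_add_sum_filter_not F (fun f => v ∈ f.ends),
      hfilter, Finset.sum_insert (by simp [T.ne₁₂, T.ne₁₃]), Finset.sum_pair T.ne₂₃, add_comm] at h
    simpa using h
  have hmain : ∀ (y : ℂ) (u : V → ℂ), (∀ f ∈ C, v ∉ f.ends → constraint P f u = 0) →
      g e₁ * (e₁.unit * (w - P a₁) * conj (y - u a₁)).re +
      g e₂ * (e₂.unit * (w - P a₂) * conj (y - u a₂)).re +
      g e₃ * (e₃.unit * (w - P a₃) * conj (y - u a₃)).re = 0 := by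
    intro y u hu
    have h := hsplit (Function.update u v y)
    rw [Finset.sum_eq_zero, zero_add, constraint_apply T.ends₁, constraint_apply T.ends₂,
      constraint_apply T.ends₃, Function.update_self, Function.update_of_ne T.vne₁.symm,
      Function.update_of_ne T.vne₂.symm, Function.update_of_ne T.vne₃.symm, hQv, hQa _ T.vne₁,
      hQa _ T.vne₂, hQa _ T.vne₃, ← add_assoc] at h
    · exact h
    · intro f hf
      simp only [hF, Finset.mem_filter, Set.Finite.mem_toFinset] at hf
      rw [hoff f hf.2 _ u fun x hx => Function.update_of_ne hx _ _, hu f hf.1 hf.2, mul_zero]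
  refine ⟨g e₁, g e₂, g e₃, ?_, ?_, ?_⟩
  -- A dependency that vanishes at the three edges would live on edges away from `v`. There `Q`
  -- agrees with `P`, and a proper subset of `C` is independent.
  · rintro ⟨h1, h2, h3⟩
    have hC₀ : LinearIndepOn ℝ (constraint P)
        (F.filter (fun f => v ∉ f.ends) : Set (MixedEdge V)) := by
      refine (hC.indep_sdiff T.mem₁).mono ?_
      intro f hf
      simp only [hF, Finset.coe_filter, Set.Finite.mem_toFinset, Set.mem_ofPred_eq] at hf
      exact ⟨hf.1, fun h => hf.2 (h ▸ ⟨a₁, T.ends₁⟩)⟩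
    have h0 := linearIndepOn_finset_iff.1 hC₀ g (by
      refine LinearMap.ext fun u => ?_
      have h := hsplit u
      rw [h1, h2, h3] at h
      simp only [zero_mul, add_zero] at h
      rw [LinearMap.sum_apply, LinearMap.zero_apply, ← h]
      refine Finset.sum_congr rfl fun f hf => ?_
      rw [Finset.mem_filter] at hf
      rw [hoff f hf.2 u u fun _ _ => rfl]
      rfl)
    by_cases hve : v ∈ e.ends
    · have : e ∈ F.filter (fun f => v ∈ f.ends) := Finset.mem_filter.2 ⟨he, hve⟩
      rw [hfilter] at this
      simp only [Finset.mem_insert, Finset.mem_singleton] at this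
      rcases this with rfl | rfl | rfl <;> contradiction
    · exact hge (h0 e (Finset.mem_filter.2 ⟨he, hve⟩))
  · have h0 := fun y => hmain y 0 fun f _ _ => map_zero _
    simp only [Pi.zero_apply, sub_zero] at h0
    set X := (g e₁ : ℂ) * (e₁.unit * (w - P a₁)) + g e₂ * (e₂.unit * (w - P a₂)) +
        g e₃ * (e₃.unit * (w - P a₃)) with hX
    -- Testing the equilibrium at `v` against the resultant `X` itself gives `|X|² = 0`.
    have h1 := h0 X
    rw [← Complex.re_ofReal_mul, ← Complex.re_ofReal_mul, ← Complex.re_ofReal_mul, ← Complex.add_re,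
      ← Complex.add_re] at h1
    rwa [show (g e₁ : ℂ) * (e₁.unit * (w - P a₁) * conj X) + g e₂ * (e₂.unit * (w - P a₂) * conj X) +
      g e₃ * (e₃.unit * (w - P a₃) * conj X) = X * conj X by
      conv_rhs => rw [hX, add_mul, add_mul, ← hX]
      ring, Complex.mul_conj, Complex.ofReal_re, Complex.normSq_eq_zero] at h1
  · intro u hu
    have h := hmain 0 u hu
    simp only [zero_sub, map_neg, mul_neg, Complex.neg_re] at h
    linarith

/-- Equilibrium at `v` forces the coefficient of the non-parallel edge `e₃` to vanish and those of
`e₁` and `e₂` to balance. What remains of the dependency is one nontrivial relation between `u a₁`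
and `u a₂`. -/
theorem re_eq_zero_of_parallel [Finite V] (T : IsTrivalentAt C v e₁ e₂ e₃ a₁ a₂ a₃)
    (hP : GenericConfig P) (hC : IsMinDep (constraint P) C) {w : ℂ} {r : ℝ} (hr : r ≠ 0)
    (h₂ : e₂.unit * (w - P a₂) = r * (e₁.unit * (w - P a₁)))
    (h₃ : ((e₃.unit * (w - P a₃)) * conj (e₁.unit * (w - P a₁))).im ≠ 0)
    {u : V → ℂ} (hu : ∀ f ∈ C, v ∉ f.ends → constraint P f u = 0) :
    (e₁.unit * (w - P a₁) * conj (u a₁ - u a₂)).re = 0 := by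
  obtain ⟨l₁, l₂, l₃, hne, hsum, hl⟩ := T.exists_stress hP hC w
  have hl := hl u hu
  rw [h₂] at hsum hl
  set f₁ := e₁.unit * (w - P a₁)
  set f₃ := e₃.unit * (w - P a₃)
  have hf₁ : f₁ ≠ 0 := by
    intro h
    exact h₃ (by simp [h])
  have hl₃ : l₃ = 0 := by
    have h := congrArg (fun z => (z * conj f₁).im) hsum
    simp only [zero_mul, Complex.zero_im] at h
    rw [show ((l₁ : ℂ) * f₁ + l₂ * (r * f₁) + l₃ * f₃) * conj f₁ =
      ((l₁ + l₂ * r : ℝ) : ℂ) * (f₁ * conj f₁) + (l₃ : ℂ) * (f₃ * conj f₁) by push_cast; ring,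
      Complex.mul_conj, Complex.add_im, Complex.im_ofReal_mul, Complex.im_ofReal_mul,
      Complex.ofReal_im, mul_zero, zero_add] at h
    exact (mul_eq_zero.1 h).resolve_right h₃
  have hl₁ : l₁ + l₂ * r = 0 := by
    rw [hl₃, Complex.ofReal_zero, zero_mul, add_zero] at hsum
    have : ((l₁ + l₂ * r : ℝ) : ℂ) * f₁ = 0 := by push_cast; linear_combination hsum
    exact_mod_cast (mul_eq_zero.1 this).resolve_right hf₁
  have hl₂ : l₂ ≠ 0 := by
    rintro rfl
    exact hne ⟨by linarith, rfl, hl₃⟩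
  rw [hl₃, zero_mul, add_zero, mul_assoc (r : ℂ), Complex.re_ofReal_mul] at hl
  rw [map_sub, mul_sub, Complex.sub_re]
  have : l₂ * r * ((f₁ * conj (u a₁)).re - (f₁ * conj (u a₂)).re) = 0 := by
    linear_combination hl₁ * (f₁ * conj (u a₁)).re - hl
  exact (mul_eq_zero.1 this).resolve_left (mul_ne_zero hl₂ hr)

/-- The special position is the midpoint of `P a₁` and `P a₂`, where the two edges are opposite. The
relation says that an edge `a₁a₂` of the same kind lies in the closure of the edges of `C` away from
`v`. -/
theorem re_eq_zero_of_unit_eq [Finite V] (T : IsTrivalentAt C v e₁ e₂ e₃ a₁ a₂ a₃)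
    (hP : GenericConfig P) (hC : IsMinDep (constraint P) C) (h₁₂ : e₁.unit = e₂.unit)
    (h₁₃ : e₁.unit = e₃.unit) {u : V → ℂ} (hu : ∀ f ∈ C, v ∉ f.ends → constraint P f u = 0) :
    (e₁.unit * (P a₁ - P a₂) * conj (u a₁ - u a₂)).re = 0 := by
  have ha : ∀ {e f : MixedEdge V} {a b : V}, e ≠ f → e.unit = f.unit → e.ends = s(v, a) →
      f.ends = s(v, b) → a ≠ b := by
    rintro e f a _ hne hu he hf rfl
    exact hne (ext_unit_ends hu (he.trans hf.symm))
  have h12 := ha T.ne₁₂ h₁₂ T.ends₁ T.ends₂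
  have h13 := ha T.ne₁₃ h₁₃ T.ends₁ T.ends₃
  have h23 := ha T.ne₂₃ (h₁₂.symm.trans h₁₃) T.ends₂ T.ends₃
  have := T.re_eq_zero_of_parallel hP hC (w := (P a₁ + P a₂) / 2) (r := -1) (by norm_num)
    (by rw [h₁₂]; push_cast; ring) ?_ hu
  · rw [show (P a₁ + P a₂) / 2 - P a₁ = ((-1 / 2 : ℝ) : ℂ) * (P a₁ - P a₂) by push_cast; ring,
      show e₁.unit * (((-1 / 2 : ℝ) : ℂ) * (P a₁ - P a₂)) * conj (u a₁ - u a₂) =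
      ((-1 / 2 : ℝ) : ℂ) * (e₁.unit * (P a₁ - P a₂) * conj (u a₁ - u a₂)) by ring,
      Complex.re_ofReal_mul] at this
    exact (mul_eq_zero.1 this).resolve_left (by norm_num)
  · rw [← h₁₃]
    have hun : e₁.unit * conj e₁.unit = 1 := by
      rcases unit_eq_or e₁ with h | h <;> rw [h] <;> simp
    have him := hP.im_ne h13 h12 h23.symm
    rw [show e₁.unit * ((P a₁ + P a₂) / 2 - P a₃) * conj (e₁.unit * ((P a₁ + P a₂) / 2 - P a₁)) =
      (e₁.unit * conj e₁.unit) * (((-1 / 2 : ℝ) : ℂ) * ((P a₁ - P a₃) * conj (P a₁ - P a₂)) +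
        ((1 / 4 : ℝ) : ℂ) * ((P a₁ - P a₂) * conj (P a₁ - P a₂))) by
      push_cast
      simp only [map_mul, map_sub, map_add, map_div₀, Complex.conj_ofNat]
      ring, hun, one_mul, Complex.add_im, Complex.im_ofReal_mul, Complex.im_ofReal_mul,
      Complex.mul_conj (P a₁ - P a₂), Complex.ofReal_im, mul_zero, add_zero]
    exact mul_ne_zero (by norm_num) him

/-- For edges of different kinds, parallel coefficients mean that `w - P a₁` and `w - P a₃` are
orthogonal, so `w` runs over the circle with diameter `P a₁ P a₃`. Two positions on it give two
independent linear conditions on `u a₁ - u a₃`. -/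
theorem eq_of_unit_ne [Finite V] (T : IsTrivalentAt C v e₁ e₂ e₃ a₁ a₂ a₃)
    (hP : GenericConfig P) (hC : IsMinDep (constraint P) C) (h₁₂ : e₁.unit = e₂.unit)
    (h₁₃ : e₁.unit ≠ e₃.unit) (ha : a₁ ≠ a₃) {u : V → ℂ}
    (hu : ∀ f ∈ C, v ∉ f.ends → constraint P f u = 0) : u a₁ = u a₃ := by
  have h12 : a₁ ≠ a₂ := by
    rintro rfl
    exact T.ne₁₂ (ext_unit_ends h₁₂ (T.ends₁.trans T.ends₂.symm))
  have hun : e₁.unit * conj e₁.unit = 1 := by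
    rcases unit_eq_or e₁ with h | h <;> rw [h] <;> simp
  obtain ⟨σ, hσ0, hσ⟩ : ∃ σ : ℝ, σ ≠ 0 ∧ e₃.unit * Complex.I = σ * e₁.unit := by
    rcases unit_eq_or e₁ with h | h <;> rcases unit_eq_or e₃ with h' | h' <;> rw [h, h'] at h₁₃ ⊢
    · exact absurd rfl h₁₃
    · exact ⟨1, by norm_num, by simp⟩
    · exact ⟨-1, by norm_num, by simp⟩
    · exact absurd rfl h₁₃
  set A := P a₃ - P a₁ with hA
  have hA0 : A ≠ 0 := sub_ne_zero.2 (hP.injective.ne ha.symm)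
  set Z := (P a₁ - P a₂) * conj A with hZ
  have hZre : Z.re ≠ 0 := by
    have := hP.re_ne h12 ha
    rw [hZ, hA, ← neg_sub (P a₁) (P a₃), map_neg, mul_neg, Complex.neg_re]
    exact neg_ne_zero.2 this
  have key : ∀ t : ℝ, t ≠ 0 → Z.im - t * Z.re ≠ 0 →
      (e₁.unit * A * (1 + t * Complex.I) * conj (u a₁ - u a₃)).re = 0 := by
    intro t ht hZt
    have hden : (1 + t ^ 2 : ℝ) ≠ 0 := by positivity
    have hdenC : ((1 + t ^ 2 : ℝ) : ℂ) ≠ 0 := by exact_mod_cast hden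
    set s : ℝ := (1 + t ^ 2)⁻¹ with hs
    have hs0 : s ≠ 0 := inv_ne_zero hden
    have hsC : (s : ℂ) * (1 + t ^ 2) = 1 := by
      rw [hs]; exact_mod_cast inv_mul_cancel₀ hden
    have hI : Complex.I * Complex.I = -1 := Complex.I_mul_I
    -- Rational parametrisation of the circle: `w - P a₁ = A / (1 - t * I)`, hence `w - P a₃ = I * t
    -- * (w - P a₁)`.
    have hwa : ∀ w, w = P a₁ + s * (A * (1 + t * Complex.I)) →
        w - P a₃ = Complex.I * t * (s * (A * (1 + t * Complex.I))) := by
      rintro w rfl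
      rw [hA]
      linear_combination (P a₃ - P a₁) * hsC - s * (P a₃ - P a₁) * t ^ 2 * hI
    have T' : IsTrivalentAt C v e₁ e₃ e₂ a₁ a₃ a₂ := T.swap.rotate
    have := T'.re_eq_zero_of_parallel hP hC (w := P a₁ + s * (A * (1 + t * Complex.I)))
      (r := σ * t) (mul_ne_zero hσ0 ht) ?_ ?_ hu
    · rw [add_sub_cancel_left, show e₁.unit * (s * (A * (1 + t * Complex.I))) *
        conj (u a₁ - u a₃) = (s : ℂ) * (e₁.unit * A * (1 + t * Complex.I) * conj (u a₁ - u a₃)) by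
        ring, Complex.re_ofReal_mul] at this
      exact (mul_eq_zero.1 this).resolve_left hs0
    · rw [hwa _ rfl, add_sub_cancel_left]
      push_cast
      linear_combination t * (s * (A * (1 + t * Complex.I))) * hσ
    · rw [add_sub_cancel_left, ← h₁₂]
      set X := (s : ℂ) * (A * (1 + t * Complex.I)) with hX
      rw [show e₁.unit * (P a₁ + X - P a₂) * conj (e₁.unit * X) =
        (e₁.unit * conj e₁.unit) * (X * conj X + (P a₁ - P a₂) * conj X) by
        rw [map_mul]; ring, hun, one_mul, Complex.mul_conj, Complex.add_im, Complex.ofReal_im,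
        zero_add, show (P a₁ - P a₂) * conj X = (s : ℂ) * (Z * (1 - t * Complex.I)) by
        rw [hX, hZ]; simp only [map_mul, map_add, Complex.conj_ofReal, Complex.conj_I, map_one]
        ring, Complex.im_ofReal_mul]
      refine mul_ne_zero hs0 ?_
      convert hZt using 1
      simp
      ring
  -- At `t = 0` the vertex would fall on `P a₃`. The other excluded value, `Z.im / Z.re`, makes the
  -- coefficient of `e₂` parallel as well.
  obtain ⟨t₁, t₂, ht, h1, h2, h3, h4⟩ : ∃ t₁ t₂ : ℝ, t₁ ≠ t₂ ∧ t₁ ≠ 0 ∧ t₂ ≠ 0 ∧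
      Z.im - t₁ * Z.re ≠ 0 ∧ Z.im - t₂ * Z.re ≠ 0 := by
    set q := Z.im / Z.re with hq
    have hq' : ∀ t, t ≠ q → Z.im - t * Z.re ≠ 0 := by
      intro t ht h
      apply ht
      rw [hq, eq_div_iff hZre]; linarith
    refine ⟨|q| + 1, |q| + 2, by linarith, by positivity, by positivity, hq' _ ?_, hq' _ ?_⟩ <;>
    · have := le_abs_self q
      intro h; linarith
  have k1 := key t₁ h1 h3
  have k2 := key t₂ h2 h4
  set Y := e₁.unit * A with hY
  set D := conj (u a₁ - u a₃) with hD
  have hsplit : ∀ t : ℝ, (Y * (1 + t * Complex.I) * D).re = (Y * D).re - t * (Y * D).im := by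
    intro t
    rw [show Y * (1 + t * Complex.I) * D = Y * D + (t : ℂ) * (Complex.I * (Y * D)) by ring,
      Complex.add_re, Complex.re_ofReal_mul, Complex.I_mul_re]
    ring
  rw [hsplit] at k1 k2
  have him : (Y * D).im = 0 := by
    have : (t₁ - t₂) * (Y * D).im = 0 := by linarith
    exact (mul_eq_zero.1 this).resolve_left (sub_ne_zero.2 ht)
  have hre : (Y * D).re = 0 := by rw [him] at k1; linarith
  have h0 : Y * D = 0 := Complex.ext hre him
  have hD0 : D = 0 := (mul_eq_zero.1 h0).resolve_left (mul_ne_zero (unit_ne_zero _) hA0)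
  rw [hD, map_eq_zero] at hD0
  exact sub_eq_zero.1 hD0

end IsTrivalentAt

/-! ### Motions of generic circuits are similarities. -/

namespace MixedEdge

variable {V : Type*} {P : V → ℂ}

theorem exists_unit_eq_ends_eq (e : MixedEdge V) (s : Sym2 V) :
    ∃ g : MixedEdge V, g.unit = e.unit ∧ g.ends = s := by
  rcases e with _ | _
  · exact ⟨Sum.inl s, rfl, rfl⟩
  · exact ⟨Sum.inr s, rfl, rfl⟩

/-- Consequently a length edge permits only imaginary `z` (rotations) and a direction edge only real
`z` (dilations). -/
theorem constraint_eq_of_affine {e : MixedEdge V} {a b : V} (h : e.ends = s(a, b)) {u : V → ℂ}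
    {t z : ℂ} (ha : u a = t + z * P a) (hb : u b = t + z * P b) :
    constraint P e u = Complex.normSq (P a - P b) * (e.unit * conj z).re := by
  rw [constraint_apply h, ha, hb, show e.unit * (P a - P b) * conj (t + z * P a - (t + z * P b)) =
    (P a - P b) * conj (P a - P b) * (e.unit * conj z) by
    simp only [map_sub, map_add, map_mul]; ring, Complex.mul_conj, Complex.re_ofReal_mul]

theorem re_unit_mul_conj_eq_zero (hP : Function.Injective P) {e : MixedEdge V} {a b : V}
    (h : e.ends = s(a, b)) (hab : a ≠ b) {u : V → ℂ} {t z : ℂ} (ha : u a = t + z * P a)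
    (hb : u b = t + z * P b) (hu : constraint P e u = 0) : (e.unit * conj z).re = 0 := by
  rw [constraint_eq_of_affine h ha hb] at hu
  exact (mul_eq_zero.1 hu).resolve_left
    (Complex.normSq_pos.2 (sub_ne_zero.2 (hP.ne hab))).ne'

theorem eq_zero_of_re_unit_mul {e f : MixedEdge V} (hef : e.unit ≠ f.unit) {z : ℂ}
    (he : (e.unit * conj z).re = 0) (hf : (f.unit * conj z).re = 0) : z = 0 := by
  rcases unit_eq_or e with h | h <;> rcases unit_eq_or f with h' | h' <;>
    rw [h, h'] at hef <;> rw [h] at he <;> rw [h'] at hf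
  · exact absurd rfl hef
  · simp at he hf; exact Complex.ext he hf
  · simp at he hf; exact Complex.ext hf he
  · exact absurd rfl hef

theorem affine_unique (hP : Function.Injective P) {a b : V} (hab : a ≠ b) {u : V → ℂ}
    {t z t' z' : ℂ} (ha : u a = t + z * P a) (hb : u b = t + z * P b) (ha' : u a = t' + z' * P a)
    (hb' : u b = t' + z' * P b) : t = t' ∧ z = z' := by
  have hz : (z - z') * (P a - P b) = 0 := by linear_combination ha' - ha - (hb' - hb)
  have hz : z = z' :=
    sub_eq_zero.1 ((mul_eq_zero.1 hz).resolve_right (sub_ne_zero.2 (hP.ne hab)))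
  subst hz
  exact ⟨by linear_combination ha' - ha, rfl⟩

theorem exists_affine_pair (hP : Function.Injective P) {a b : V} (hab : a ≠ b) (u : V → ℂ) :
    ∃ t z, u a = t + z * P a ∧ u b = t + z * P b := by
  have h : P a - P b ≠ 0 := sub_ne_zero.2 (hP.ne hab)
  refine ⟨u a - (u a - u b) / (P a - P b) * P a, (u a - u b) / (P a - P b), by ring, ?_⟩
  field_simp
  ring

/-- If the circuits through `g` in `C₀ + g` only have the motions `x ↦ t + z P x`, and `g` is in the
closure of `C₀`, then `C₀` contains a set with the same property. -/
theorem exists_affine_subset [Finite V] (hP : Function.Injective P) {C₀ : Set (MixedEdge V)}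
    {g : MixedEdge V} {a b : V} (hg : g.ends = s(a, b)) (hab : a ≠ b)
    (hcl : ∀ u, (∀ f ∈ C₀, constraint P f u = 0) → constraint P g u = 0)
    (ih : ∀ C', IsMinDep (constraint P) C' → C' ⊆ insert g C₀ → ∀ u,
      (∀ f ∈ C', constraint P f u = 0) → ∃ t z : ℂ, ∀ x ∈ verts C', u x = t + z * P x) :
    ∃ B ⊆ C₀, ∀ u, (∀ f ∈ B, constraint P f u = 0) →
      ∃ t z : ℂ, (∀ x ∈ verts B, u x = t + z * P x) ∧ u a = t + z * P a ∧ u b = t + z * P b ∧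
        (g.unit * conj z).re = 0 := by
  by_cases hgC : g ∈ C₀
  · refine ⟨{g}, by simpa using hgC, fun u hu => ?_⟩
    obtain ⟨t, z, ha, hb⟩ := exists_affine_pair hP hab u
    refine ⟨t, z, ?_, ha, hb, re_unit_mul_conj_eq_zero hP hg hab ha hb (hu g rfl)⟩
    rintro x ⟨f, rfl, hx⟩
    rw [hg, Sym2.mem_iff] at hx
    rcases hx with rfl | rfl <;> assumption
  · obtain ⟨C, hC, hgC', hCsub⟩ := exists_isMinDep_of_forall_apply_eq_zero (constraint P) hgC hcl
    -- Removing `g` from a circuit does not change its motions.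
    refine ⟨C \ {g}, ?_, fun u hu => ?_⟩
    · rintro f ⟨hf, hfg⟩
      exact (hCsub hf).resolve_left hfg
    · have hu' : constraint P g u = 0 := hC.apply_eq_zero hgC' fun f hf hfg => hu f ⟨hf, hfg⟩
      obtain ⟨t, z, h⟩ := ih C hC hCsub u fun f hf => by
        by_cases hfg : f = g
        · exact hfg ▸ hu'
        · exact hu f ⟨hf, hfg⟩
      have ha := h a (mem_verts_left hgC' hg)
      have hb := h b (mem_verts_right hgC' hg)
      exact ⟨t, z, fun x hx => h x (verts_mono Set.sdiff_subset hx), ha, hb,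
        re_unit_mul_conj_eq_zero hP hg hab ha hb hu'⟩

theorem forall_of_union {A B : Set (MixedEdge V)} {u : V → ℂ}
    (h : ∀ f ∈ A ∪ B, constraint P f u = 0) :
    (∀ f ∈ A, constraint P f u = 0) ∧ ∀ f ∈ B, constraint P f u = 0 :=
  ⟨fun f hf => h f (Or.inl hf), fun f hf => h f (Or.inr hf)⟩

theorem verts_union (A B : Set (MixedEdge V)) : verts (A ∪ B) = verts A ∪ verts B := by
  ext x
  simp only [verts, Set.mem_union, Set.mem_ofPred_eq]
  constructor
  · rintro ⟨e, he | he, hx⟩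
    · exact Or.inl ⟨e, he, hx⟩
    · exact Or.inr ⟨e, he, hx⟩
  · rintro (⟨e, he, hx⟩ | ⟨e, he, hx⟩)
    · exact ⟨e, Or.inl he, hx⟩
    · exact ⟨e, Or.inr he, hx⟩

/-- If `u a = u b` is forced, then both the direction edge and the length edge `ab` lie in the
closure of `C₀`. The two resulting similarities agree at `a` and `b`, hence coincide, and having
both kinds of edges makes `z = 0`. -/
theorem exists_constant_subset [Finite V] (hP : Function.Injective P) {C₀ : Set (MixedEdge V)}
    {a b : V} (hab : a ≠ b) (hcl : ∀ u, (∀ f ∈ C₀, constraint P f u = 0) → u a = u b)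
    (ih : ∀ g : MixedEdge V, g.ends = s(a, b) →
      ∀ C', IsMinDep (constraint P) C' → C' ⊆ insert g C₀ → ∀ u,
      (∀ f ∈ C', constraint P f u = 0) → ∃ t z : ℂ, ∀ x ∈ verts C', u x = t + z * P x) :
    ∃ B ⊆ C₀, ∀ u, (∀ f ∈ B, constraint P f u = 0) →
      ∃ t : ℂ, (∀ x ∈ verts B, u x = t) ∧ u a = t ∧ u b = t := by
  have hcl' : ∀ g : MixedEdge V, g.ends = s(a, b) → ∀ u, (∀ f ∈ C₀, constraint P f u = 0) →
      constraint P g u = 0 := by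
    intro g hg u hu
    rw [constraint_apply hg, hcl u hu, sub_self, map_zero, mul_zero, Complex.zero_re]
  obtain ⟨B₁, hB₁, h₁⟩ := exists_affine_subset hP (g := Sum.inl s(a, b)) rfl hab (hcl' _ rfl)
    (ih _ rfl)
  obtain ⟨B₂, hB₂, h₂⟩ := exists_affine_subset hP (g := Sum.inr s(a, b)) rfl hab (hcl' _ rfl)
    (ih _ rfl)
  refine ⟨B₁ ∪ B₂, Set.union_subset hB₁ hB₂, fun u hu => ?_⟩
  obtain ⟨t, z, h, ha, hb, hz⟩ := h₁ u (forall_of_union hu).1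
  obtain ⟨t', z', h', ha', hb', hz'⟩ := h₂ u (forall_of_union hu).2
  obtain ⟨rfl, rfl⟩ := affine_unique hP hab ha hb ha' hb'
  have hz0 : z = 0 := eq_zero_of_re_unit_mul (e := Sum.inl s(a, b)) (f := Sum.inr s(a, b))
    (by simp [unit, Complex.ext_iff]) hz hz'
  subst hz0
  simp only [zero_mul, add_zero] at *
  refine ⟨t, fun x hx => ?_, ha, hb⟩
  rw [verts_union] at hx
  exact hx.elim (h x) (h' x)

end MixedEdge

namespace IsTrivalentAt

variable {V : Type*} {P : V → ℂ} {C : Set (MixedEdge V)} {v : V} {e₁ e₂ e₃ : MixedEdge V}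
  {a₁ a₂ a₃ : V}

/-- The set `F` with `e₁` and `e₂` already fixes the motion at `v` as the same similarity, so `e₃`
is redundant. The dependent set `F ∪ {e₁, e₂, e₃}` must then be all of `C`, by minimality, and the
motions of `C` are similarities. -/
theorem exists_affine_of_skeleton [Finite V] (T : IsTrivalentAt C v e₁ e₂ e₃ a₁ a₂ a₃)
    (hP : GenericConfig P) (hC : IsMinDep (constraint P) C) {F : Set (MixedEdge V)}
    (hFC : F ⊆ {f ∈ C | v ∉ f.ends})
    (hF : ∀ u, (∀ f ∈ F, constraint P f u = 0) → ∃ t z : ℂ, (∀ x ∈ verts F, u x = t + z * P x) ∧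
      u a₁ = t + z * P a₁ ∧ u a₂ = t + z * P a₂ ∧ u a₃ = t + z * P a₃ ∧
      (e₁.unit * conj z).re = 0 ∧ (e₂.unit * conj z).re = 0 ∧ (e₃.unit * conj z).re = 0)
    (u : V → ℂ) (hu : ∀ f ∈ C, constraint P f u = 0) :
    ∃ t z : ℂ, ∀ x ∈ verts C, u x = t + z * P x := by
  have key : ∀ u : V → ℂ, (∀ f ∈ insert e₂ (insert e₁ F), constraint P f u = 0) →
      ∃ t z : ℂ, (∀ x ∈ verts F, u x = t + z * P x) ∧
      u a₁ = t + z * P a₁ ∧ u a₂ = t + z * P a₂ ∧ u a₃ = t + z * P a₃ ∧ u v = t + z * P v ∧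
      (e₃.unit * conj z).re = 0 := by
    intro u hu
    obtain ⟨t, z, h, h₁, h₂, h₃, r₁, r₂, r₃⟩ :=
      hF u fun f hf => hu f (Set.mem_insert_of_mem _ (Set.mem_insert_of_mem _ hf))
    refine ⟨t, z, h, h₁, h₂, h₃, ?_, r₃⟩
    -- The deviation of `u v` from the similarity is orthogonal to the coefficient of each edge at
    -- `v`. Two independent coefficients force it to vanish.
    have hval : ∀ {e : MixedEdge V} {a : V}, e.ends = s(v, a) → u a = t + z * P a →
        (e.unit * conj z).re = 0 → constraint P e u = 0 →
        (e.unit * (P v - P a) * conj (u v - (t + z * P v))).re = 0 := by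
      intro e a he ha hr hc
      rw [constraint_apply he, ha] at hc
      rw [show e.unit * (P v - P a) * conj (u v - (t + z * P v)) =
        e.unit * (P v - P a) * conj (u v - (t + z * P a)) -
          (P v - P a) * conj (P v - P a) * (e.unit * conj z) by
        simp only [map_sub, map_add, map_mul]; ring, Complex.sub_re, hc, Complex.mul_conj,
        Complex.re_ofReal_mul, hr, mul_zero, sub_zero]
    have k₁ := hval T.ends₁ h₁ r₁ (hu e₁ (by simp))
    have k₂ := hval T.ends₂ h₂ r₂ (hu e₂ (by simp))
    have him := hP.im_unit_mul_ne T.ne₁₂ T.ends₁ T.ends₂ T.vne₁ T.vne₂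
    set f₁ := e₁.unit * (P v - P a₁)
    set f₂ := e₂.unit * (P v - P a₂)
    set y := u v - (t + z * P v)
    suffices y = 0 from sub_eq_zero.1 this
    simp only [Complex.mul_re, Complex.mul_im, Complex.conj_re, Complex.conj_im] at k₁ k₂ him
    refine Complex.ext ?_ ?_
    · refine (mul_eq_zero.1 (?_ : (f₁.re * -f₂.im + f₁.im * f₂.re) * y.re = 0)).resolve_left him
      linear_combination f₁.im * k₂ - f₂.im * k₁
    · refine (mul_eq_zero.1 (?_ : (f₁.re * -f₂.im + f₁.im * f₂.re) * y.im = 0)).resolve_left him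
      linear_combination f₂.re * k₁ - f₁.re * k₂
  have hdep : ¬ LinearIndepOn ℝ (constraint P) (insert e₃ (insert e₂ (insert e₁ F))) := by
    intro hind
    have hnot : e₃ ∉ insert e₂ (insert e₁ F) := by
      rintro (h | h | h)
      · exact T.ne₂₃ h.symm
      · exact T.ne₁₃ h.symm
      · exact (hFC h).2 ⟨a₃, T.ends₃⟩
    obtain ⟨u, hu, hne⟩ := exists_apply_ne_zero_of_linearIndepOn_insert hnot hind
    obtain ⟨t, z, -, -, -, h₃, hv, hr⟩ := key u hu
    refine hne ?_
    rw [constraint_eq_of_affine T.ends₃ hv h₃, hr, mul_zero]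
  have hsub : insert e₃ (insert e₂ (insert e₁ F)) ⊆ C :=
    Set.insert_subset T.mem₃ (Set.insert_subset T.mem₂ (Set.insert_subset T.mem₁
      fun f hf => (hFC hf).1))
  have hCsub := hC.2 hdep hsub
  obtain ⟨t, z, h, h₁, h₂, h₃, hv, -⟩ := key u fun f hf => hu f (hsub (Set.mem_insert_of_mem _ hf))
  refine ⟨t, z, ?_⟩
  rintro x ⟨e, he, hx⟩
  rcases hCsub he with rfl | rfl | rfl | he
  · rw [T.ends₃, Sym2.mem_iff] at hx; rcases hx with rfl | rfl <;> assumption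
  · rw [T.ends₂, Sym2.mem_iff] at hx; rcases hx with rfl | rfl <;> assumption
  · rw [T.ends₁, Sym2.mem_iff] at hx; rcases hx with rfl | rfl <;> assumption
  · exact h x ⟨e, he, hx⟩

/-- Each pair of neighbours of `v` lies in a set with similarity motions, and all three factors `z`
are real multiples of `I * e₁.unit`. Going round the triangle gives a linear relation between its
sides; as the triangle is not degenerate, the three similarities coincide. -/
theorem exists_affine_of_unit_eq [Finite V] (T : IsTrivalentAt C v e₁ e₂ e₃ a₁ a₂ a₃)
    (hP : GenericConfig P) (hC : IsMinDep (constraint P) C)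
    (ih : ∀ C', IsMinDep (constraint P) C' → ∀ g : MixedEdge V, ¬ g.ends.IsDiag →
      C' ⊆ insert g {f ∈ C | v ∉ f.ends} → ∀ u,
      (∀ f ∈ C', constraint P f u = 0) → ∃ t z : ℂ, ∀ x ∈ verts C', u x = t + z * P x)
    (h₁₂ : e₁.unit = e₂.unit) (h₁₃ : e₁.unit = e₃.unit)
    (u : V → ℂ) (hu : ∀ f ∈ C, constraint P f u = 0) :
    ∃ t z : ℂ, ∀ x ∈ verts C, u x = t + z * P x := by
  have ha : ∀ {e f : MixedEdge V} {a b : V}, e ≠ f → e.unit = f.unit → e.ends = s(v, a) →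
      f.ends = s(v, b) → a ≠ b := by
    rintro e f a _ hne hu he hf rfl
    exact hne (ext_unit_ends hu (he.trans hf.symm))
  have h12 := ha T.ne₁₂ h₁₂ T.ends₁ T.ends₂
  have h13 := ha T.ne₁₃ h₁₃ T.ends₁ T.ends₃
  have h23 := ha T.ne₂₃ (h₁₂.symm.trans h₁₃) T.ends₂ T.ends₃
  have hbody : ∀ {f₁ f₂ f₃ : MixedEdge V} {b₁ b₂ b₃ : V}, IsTrivalentAt C v f₁ f₂ f₃ b₁ b₂ b₃ →
      f₁.unit = f₂.unit → f₁.unit = f₃.unit → b₁ ≠ b₂ → ∃ B ⊆ {f ∈ C | v ∉ f.ends},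
      ∀ u, (∀ f ∈ B, constraint P f u = 0) →
      ∃ t z : ℂ, (∀ x ∈ verts B, u x = t + z * P x) ∧ u b₁ = t + z * P b₁ ∧ u b₂ = t + z * P b₂ ∧
        (f₁.unit * conj z).re = 0 := by
    intro f₁ f₂ f₃ b₁ b₂ b₃ T' hf₁₂ hf₁₃ hb
    obtain ⟨g, hg, hg'⟩ := exists_unit_eq_ends_eq f₁ s(b₁, b₂)
    rw [← hg]
    refine exists_affine_subset hP.injective hg' hb (fun u hu => ?_) fun C' hC' hsub =>
      ih C' hC' g (by rw [hg', Sym2.mk_isDiag_iff]; exact hb) hsub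
    rw [constraint_apply hg', hg]
    exact T'.re_eq_zero_of_unit_eq hP hC hf₁₂ hf₁₃ fun f hf hv => hu f ⟨hf, hv⟩
  obtain ⟨B₁, hB₁, hm₁⟩ := hbody T h₁₂ h₁₃ h12
  obtain ⟨B₂, hB₂, hm₂⟩ := hbody T.rotate (h₁₂.symm.trans h₁₃) h₁₂.symm h23
  obtain ⟨B₃, hB₃, hm₃⟩ := hbody T.rotate.rotate h₁₃.symm (h₁₃.symm.trans h₁₂) h13.symm
  refine T.exists_affine_of_skeleton hP hC (F := B₁ ∪ (B₂ ∪ B₃))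
    (Set.union_subset hB₁ (Set.union_subset hB₂ hB₃)) (fun u hu => ?_) u hu
  obtain ⟨hu₁, hu'⟩ := forall_of_union hu
  obtain ⟨hu₂, hu₃⟩ := forall_of_union hu'
  obtain ⟨t, z, m₁, p₁, p₂, r₁⟩ := hm₁ u hu₁
  obtain ⟨t', z', m₂, q₂, q₃, r₂⟩ := hm₂ u hu₂
  obtain ⟨t'', z'', m₃, s₃, s₁, r₃⟩ := hm₃ u hu₃
  rw [← h₁₂] at r₂
  rw [← h₁₃] at r₃
  have hsum : z * (P a₁ - P a₂) + z' * (P a₂ - P a₃) + z'' * (P a₃ - P a₁) = 0 := by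
    linear_combination s₁ - p₁ + p₂ - q₂ + q₃ - s₃
  have hun : e₁.unit * conj e₁.unit = 1 := by
    rcases unit_eq_or e₁ with h | h <;> rw [h] <;> simp
  have hreal : ∀ {y : ℂ}, (e₁.unit * conj y).re = 0 →
      ∃ r : ℝ, y = Complex.I * e₁.unit * r := by
    intro y hy
    refine ⟨-(e₁.unit * conj y).im, ?_⟩
    have h1 : e₁.unit * conj y = ((e₁.unit * conj y).im : ℂ) * Complex.I := by
      have := Complex.re_add_im (e₁.unit * conj y)
      rw [hy, Complex.ofReal_zero, zero_add] at this
      exact this.symm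
    have h2 := congrArg conj h1
    simp only [map_mul, Complex.conj_conj, Complex.conj_ofReal, Complex.conj_I] at h2
    push_cast
    linear_combination e₁.unit * h2 - y * hun
  obtain ⟨r, rfl⟩ := hreal r₁
  obtain ⟨r', rfl⟩ := hreal r₂
  obtain ⟨r'', rfl⟩ := hreal r₃
  have hlin : ((r - r'' : ℝ) : ℂ) * (P a₁ - P a₂) - ((r' - r'' : ℝ) : ℂ) * (P a₃ - P a₂) = 0 := by
    have h0 : Complex.I * e₁.unit ≠ 0 := mul_ne_zero Complex.I_ne_zero (unit_ne_zero _)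
    refine (mul_eq_zero.1 (?_ : Complex.I * e₁.unit * _ = 0)).resolve_left h0
    push_cast
    linear_combination hsum
  have hr' : r' = r'' := by
    have h := congrArg (fun y => (y * conj (P a₂ - P a₁)).im) hlin
    simp only [zero_mul, Complex.zero_im] at h
    rw [show (((r - r'' : ℝ) : ℂ) * (P a₁ - P a₂) - ((r' - r'' : ℝ) : ℂ) * (P a₃ - P a₂)) *
      conj (P a₂ - P a₁) = ((r'' - r : ℝ) : ℂ) * ((P a₂ - P a₁) * conj (P a₂ - P a₁)) +
      ((r' - r'' : ℝ) : ℂ) * ((P a₂ - P a₃) * conj (P a₂ - P a₁)) by push_cast; ring,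
      Complex.add_im, Complex.im_ofReal_mul, Complex.im_ofReal_mul, Complex.mul_conj,
      Complex.ofReal_im, mul_zero, zero_add] at h
    have hn := hP.im_ne h23 h12.symm h13.symm
    exact sub_eq_zero.1 ((mul_eq_zero.1 h).resolve_right hn)
  have hr : r = r'' := by
    rw [hr', sub_self, Complex.ofReal_zero, zero_mul, sub_zero] at hlin
    have := (mul_eq_zero.1 hlin).resolve_right (sub_ne_zero.2 (hP.injective.ne h12))
    exact sub_eq_zero.1 (by exact_mod_cast this)
  subst hr' hr
  have ht' : t = t' := by linear_combination q₂ - p₂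
  have ht'' : t = t'' := by linear_combination s₁ - p₁
  subst ht' ht''
  refine ⟨t, _, fun x hx => ?_, p₁, p₂, q₃, r₁, h₁₂ ▸ r₁, h₁₃ ▸ r₁⟩
  rw [verts_union, verts_union] at hx
  rcases hx with hx | hx | hx
  · exact m₁ x hx
  · exact m₂ x hx
  · exact m₃ x hx

/-- Both `a₁` and `a₂` are tied to `a₃` by sets with constant motions, so the skeleton has `z = 0`.
A neighbour that equals `a₃` (parallel edges of different kinds) needs no set at all. -/
theorem exists_affine_of_unit_ne [Finite V] (T : IsTrivalentAt C v e₁ e₂ e₃ a₁ a₂ a₃)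
    (hP : GenericConfig P) (hC : IsMinDep (constraint P) C)
    (ih : ∀ C', IsMinDep (constraint P) C' → ∀ g : MixedEdge V, ¬ g.ends.IsDiag →
      C' ⊆ insert g {f ∈ C | v ∉ f.ends} → ∀ u,
      (∀ f ∈ C', constraint P f u = 0) → ∃ t z : ℂ, ∀ x ∈ verts C', u x = t + z * P x)
    (h₁₂ : e₁.unit = e₂.unit) (h₁₃ : e₁.unit ≠ e₃.unit)
    (u : V → ℂ) (hu : ∀ f ∈ C, constraint P f u = 0) :
    ∃ t z : ℂ, ∀ x ∈ verts C, u x = t + z * P x := by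
  have hbody : ∀ {f₁ f₂ : MixedEdge V} {b₁ b₂ : V}, IsTrivalentAt C v f₁ f₂ e₃ b₁ b₂ a₃ →
      f₁.unit = f₂.unit → f₁.unit ≠ e₃.unit → ∃ B ⊆ {f ∈ C | v ∉ f.ends},
      ∀ u, (∀ f ∈ B, constraint P f u = 0) →
      (∀ x ∈ verts B, u x = u a₃) ∧ u b₁ = u a₃ := by
    intro f₁ f₂ b₁ b₂ T' hf₁₂ hf₁₃
    by_cases hb : b₁ = a₃
    · refine ⟨∅, Set.empty_subset _, fun u _ => ⟨?_, hb ▸ rfl⟩⟩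
      rintro x ⟨e, he, -⟩
      exact he.elim
    · obtain ⟨B, hB, h⟩ := exists_constant_subset (C₀ := {f ∈ C | v ∉ f.ends}) hP.injective hb
        (fun u hu => T'.eq_of_unit_ne hP hC hf₁₂ hf₁₃ hb fun f hf hv => hu f ⟨hf, hv⟩)
        fun g hg C' hC' hsub => ih C' hC' g (by rw [hg, Sym2.mk_isDiag_iff]; exact hb) hsub
      refine ⟨B, hB, fun u hu => ?_⟩
      obtain ⟨t, h1, h2, h3⟩ := h u hu
      rw [h3]
      exact ⟨h1, h2⟩
  obtain ⟨B₁, hB₁, hm₁⟩ := hbody T h₁₂ h₁₃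
  obtain ⟨B₂, hB₂, hm₂⟩ := hbody T.swap h₁₂.symm (h₁₂ ▸ h₁₃)
  refine T.exists_affine_of_skeleton hP hC (F := B₁ ∪ B₂)
    (Set.union_subset hB₁ hB₂) (fun u hu => ?_) u hu
  obtain ⟨k₁, k₁'⟩ := hm₁ u (forall_of_union hu).1
  obtain ⟨k₂, k₂'⟩ := hm₂ u (forall_of_union hu).2
  refine ⟨u a₃, 0, fun x hx => ?_, by simpa, by simpa, by simp, by simp, by simp, by simp⟩
  rw [zero_mul, add_zero]
  rw [verts_union] at hx
  exact hx.elim (k₁ x) (k₂ x)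

end IsTrivalentAt

/-- At a generic configuration, each motion of a circuit is a similarity of its vertex set. -/
theorem GenericConfig.exists_affine_of_isMinDep {V : Type*} [Finite V] {P : V → ℂ}
    (hP : GenericConfig P) {C : Set (MixedEdge V)} (hC : IsMinDep (constraint P) C)
    (hdiag : ∀ e ∈ C, ¬ e.ends.IsDiag) (u : V → ℂ) (hu : ∀ f ∈ C, constraint P f u = 0) :
    ∃ t z : ℂ, ∀ x ∈ verts C, u x = t + z * P x := by
  induction hn : C.ncard using Nat.strong_induction_on generalizing C u with
  | _ n ih =>
    subst hn
    obtain ⟨v, hv⟩ := hP.exists_degree_eq_three hC hdiag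
    obtain ⟨e₁, e₂, e₃, h12, h13, h23, hset⟩ := Set.ncard_eq_three.1 hv
    have hmem : ∀ {e}, e ∈ ({e₁, e₂, e₃} : Set (MixedEdge V)) → e ∈ C ∧ v ∈ e.ends :=
      fun {e} he => by rw [← hset] at he; exact he
    obtain ⟨h1, a₁, ha₁⟩ := hmem (e := e₁) (by simp)
    obtain ⟨h2, a₂, ha₂⟩ := hmem (e := e₂) (by simp)
    obtain ⟨h3, a₃, ha₃⟩ := hmem (e := e₃) (by simp)
    have hne : ∀ {e : MixedEdge V} {a}, e ∈ C → e.ends = s(v, a) → v ≠ a := by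
      intro e a he h
      have := hdiag e he
      rwa [h, Sym2.mk_isDiag_iff] at this
    have T : IsTrivalentAt C v e₁ e₂ e₃ a₁ a₂ a₃ :=
      ⟨h12, h13, h23, h1, h2, h3, ha₁, ha₂, ha₃, hne h1 ha₁, hne h2 ha₂, hne h3 ha₃,
        fun f hf hvf => by
          have : f ∈ ({e₁, e₂, e₃} : Set (MixedEdge V)) := hset ▸ ⟨hf, hvf⟩
          simpa using this⟩
    have ih' : ∀ C', IsMinDep (constraint P) C' → ∀ g : MixedEdge V, ¬ g.ends.IsDiag →
        C' ⊆ insert g {f ∈ C | v ∉ f.ends} → ∀ u,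
        (∀ f ∈ C', constraint P f u = 0) → ∃ t z : ℂ, ∀ x ∈ verts C', u x = t + z * P x := by
      intro C' hC' g hg hsub u hu
      -- Three edges at `v` are lost and one edge `g` is gained.
      refine ih C'.ncard ?_ hC' (fun e he => ?_) u hu rfl
      · have k1 := Set.ncard_le_ncard hsub (Set.toFinite _)
        have k2 := Set.ncard_insert_le g {f ∈ C | v ∉ f.ends}
        have k3 : {f ∈ C | v ∉ f.ends}.ncard + {f ∈ C | v ∈ f.ends}.ncard = C.ncard := by
          rw [← Set.ncard_union_eq (Set.disjoint_left.2 fun f hf hf' => hf.2 hf'.2)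
            (Set.toFinite _) (Set.toFinite _)]
          congr 1
          ext f
          simp only [Set.mem_union, Set.mem_ofPred_eq]
          tauto
        omega
      · rcases hsub he with rfl | he
        · exact hg
        · exact hdiag e he.1
    -- There are only two kinds of edges, so at least two of the three agree; rotating puts such a
    -- pair first.
    by_cases hu12 : e₁.unit = e₂.unit
    · by_cases hu13 : e₁.unit = e₃.unit
      · exact T.exists_affine_of_unit_eq hP hC ih' hu12 hu13 u hu
      · exact T.exists_affine_of_unit_ne hP hC ih' hu12 hu13 u hu
    · by_cases hu13 : e₁.unit = e₃.unit
      · exact T.rotate.rotate.exists_affine_of_unit_ne hP hC ih' hu13.symm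
          (fun h => hu12 (hu13.trans h)) u hu
      · have hu23 : e₂.unit = e₃.unit := by
          rcases unit_eq_or e₁ with h | h <;> rcases unit_eq_or e₂ with h' | h' <;>
            rcases unit_eq_or e₃ with h'' | h'' <;> rw [h'] at hu12 ⊢ <;> rw [h''] at hu13 ⊢ <;>
            first | exact absurd h hu12 | exact absurd h hu13
        exact T.rotate.exists_affine_of_unit_ne hP hC ih' hu23 (fun h => hu12 h.symm) u hu

/-! ### Circuits of the rigidity matroid. -/

namespace MixedGraph

variable {V : Type*}

theorem not_isDiag_of_mem_edges {G : MixedGraph V} {e : MixedEdge V} (he : e ∈ G.edges) :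
    ¬ e.ends.IsDiag := by
  rcases he with ⟨s, hs, rfl⟩ | ⟨s, hs, rfl⟩
  · exact G.D.not_isDiag_of_mem_edgeSet hs
  · exact G.L.not_isDiag_of_mem_edgeSet hs

theorem edges_deleteEdge (G : MixedGraph V) (e : MixedEdge V) :
    (G.deleteEdge e).edges = G.edges \ {e} := by
  ext f
  rcases f with s | s <;> simp [edges, deleteEdge]

theorem frameworkMatroid_indep [Finite V] {G : MixedGraph V} {p : V → Plane}
    {I : Set (MixedEdge V)} : (G.frameworkMatroid p).Indep I ↔
      I ⊆ G.edges ∧ LinearIndepOn ℝ (constraint (toComplex ∘ p)) I := by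
  rw [← linearIndepOn_row_iff]
  simp [frameworkMatroid]

theorem frameworkMatroid_E [Finite V] (G : MixedGraph V) (p : V → Plane) :
    (G.frameworkMatroid p).E = G.edges := rfl

theorem frameworkMatroid_isCircuit [Finite V] {G : MixedGraph V} {p : V → Plane}
    {C : Set (MixedEdge V)} : (G.frameworkMatroid p).IsCircuit C ↔
      C ⊆ G.edges ∧ IsMinDep (constraint (toComplex ∘ p)) C := by
  have key : ∀ {S}, S ⊆ G.edges → ((G.frameworkMatroid p).Indep S ↔
      LinearIndepOn ℝ (constraint (toComplex ∘ p)) S) := fun h => by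
    rw [frameworkMatroid_indep, and_iff_right h]
  constructor
  · intro h
    have hsub : C ⊆ G.edges := h.subset_ground
    rw [Matroid.isCircuit_iff_minimal_not_indep hsub] at h
    refine ⟨hsub, fun hC => h.1 ((key hsub).2 hC), fun S hS hSC => ?_⟩
    exact h.2 (fun hS' => hS ((key (Set.Subset.trans hSC hsub)).1 hS')) hSC
  · rintro ⟨hsub, h⟩
    rw [Matroid.isCircuit_iff_minimal_not_indep hsub]
    refine ⟨fun hC => h.1 ((key hsub).1 hC), fun S hS hSC => ?_⟩
    exact h.2 (fun hS' => hS ((key (Set.Subset.trans hSC hsub)).2 hS')) hSC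

/-- All generic realisations of `G` have the same rigidity matroid. -/
theorem rigidityMatroid_eq [Finite V] (G : MixedGraph V) {p : V → Plane} (hp : IsGeneric p) :
    G.rigidityMatroid = G.frameworkMatroid p := by
  have h₀ := (exists_isGeneric V).choose_spec
  unfold rigidityMatroid
  generalize (exists_isGeneric V).choose = q at h₀ ⊢
  refine Matroid.ext_indep ((frameworkMatroid_E G q).trans (frameworkMatroid_E G p).symm) fun I _ => ?_
  rw [frameworkMatroid_indep, frameworkMatroid_indep]
  exact and_congr_right fun _ =>
    ⟨fun h => hp.genericConfig.indep _ _ h, fun h => h₀.genericConfig.indep _ _ h⟩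

end MixedGraph

/-! ### Lying in a common circuit is an equivalence relation. -/

namespace Matroid

variable {α : Type*}

/-- Two elements of a matroid are equal or lie in a common circuit. -/
def Linked (M : Matroid α) (e f : α) : Prop := e = f ∨ ∃ C, M.IsCircuit C ∧ e ∈ C ∧ f ∈ C

theorem Linked.symm {M : Matroid α} {e f : α} (h : M.Linked e f) : M.Linked f e := by
  rcases h with rfl | ⟨C, hC, he, hf⟩
  · exact Or.inl rfl
  · exact Or.inr ⟨C, hC, hf, he⟩

/-- Strong elimination of a common element `g` yields circuits `C₃ ∋ e` and `C₄ ∋ f` inside the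
union without `g`, and `C₃` has an element `x` of `C₂` outside `C₁`. If `x ∈ C₄`, the pair `C₃`,
`C₄` has a smaller union; if not, the pair `C₁`, `C₄` has. -/
theorem exists_isCircuit_of_inter_nonempty [Finite α] {M : Matroid α} {e f : α} {C₁ C₂ : Set α}
    (h₁ : M.IsCircuit C₁) (h₂ : M.IsCircuit C₂) (he : e ∈ C₁) (hf : f ∈ C₂)
    (hne : (C₁ ∩ C₂).Nonempty) : ∃ C, M.IsCircuit C ∧ e ∈ C ∧ f ∈ C := by
  induction hn : (C₁ ∪ C₂).ncard using Nat.strong_induction_on generalizing C₁ C₂ with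
  | _ n ih =>
    subst hn
    by_contra hcon
    have hcon' := hcon
    push Not at hcon
    have hf₁ : f ∉ C₁ := hcon C₁ h₁ he
    have he₂ : e ∉ C₂ := fun h => hcon C₂ h₂ h hf
    obtain ⟨g, hg₁, hg₂⟩ := hne
    have hlt : ∀ {S : Set α}, S ⊆ (C₁ ∪ C₂) \ {g} → S.ncard < (C₁ ∪ C₂).ncard := by
      intro S hS
      refine Set.ncard_lt_ncard ⟨hS.trans Set.sdiff_subset, fun h => ?_⟩ (Set.toFinite _)
      exact (hS (h (Or.inl hg₁))).2 rfl
    obtain ⟨C₃, hs₃, h₃, he₃⟩ := h₁.strong_elimination h₂ hg₁ hg₂ he he₂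
    obtain ⟨C₄, hs₄, h₄, hf₄⟩ := h₂.strong_elimination h₁ hg₂ hg₁ hf hf₁
    rw [Set.union_comm C₂] at hs₄
    have hmeet : ∀ {A B C : Set α}, M.IsCircuit A → M.IsCircuit C → C ⊆ (A ∪ B) \ {g} → g ∈ A →
        ∃ x ∈ C, x ∈ B ∧ x ∉ A := by
      intro A B C hA hC hs hg
      by_contra! hx
      have hCA : C ⊆ A := fun x hxC => by
        by_contra hxA
        exact hxA (hx x hxC ((hs hxC).1.resolve_left hxA))
      have := hC.eq_of_subset_isCircuit hA hCA
      subst this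
      exact (hs hg).2 rfl
    obtain ⟨x, hx₃, hx₂, hx₁⟩ := hmeet h₁ h₃ hs₃ hg₁
    have hx₄ : x ∈ C₄ := by
      by_contra hx₄
      obtain ⟨y, hy₄, hy₁, -⟩ := hmeet (B := C₁) h₂ h₄ (by rwa [Set.union_comm C₂]) hg₂
      refine hcon' ?_
      exact ih (C₁ ∪ C₄).ncard (Set.ncard_lt_ncard ⟨Set.union_subset Set.subset_union_left
        (hs₄.trans Set.sdiff_subset), fun h => (h (Or.inr hx₂)).elim hx₁ hx₄⟩ (Set.toFinite _))
        h₁ h₄ he hf₄ ⟨y, hy₁, hy₄⟩ rfl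
    exact hcon' (ih (C₃ ∪ C₄).ncard (hlt (Set.union_subset hs₃ hs₄)) h₃ h₄ he₃ hf₄
      ⟨x, hx₃, hx₄⟩ rfl)

theorem Linked.trans [Finite α] {M : Matroid α} {e f g : α} (h₁ : M.Linked e f)
    (h₂ : M.Linked f g) : M.Linked e g := by
  rcases h₁ with rfl | ⟨C, hC, he, hf⟩
  · exact h₂
  · rcases h₂ with rfl | ⟨C', hC', hf', hg⟩
    · exact Or.inr ⟨C, hC, he, hf⟩
    · exact Or.inr (exists_isCircuit_of_inter_nonempty hC hC' he hg ⟨f, hf, hf'⟩)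

end Matroid

/-! ### Rigidity and infinitesimal rigidity. -/

open Filter Topology

/-- The point of the plane that belongs to a complex number. -/
noncomputable def ofComplex (z : ℂ) : Plane := Complex.orthonormalBasisOneI.repr z

theorem toComplex_ofComplex (z : ℂ) : toComplex (ofComplex z) = z :=
  Complex.orthonormalBasisOneI.repr.symm_apply_apply z

theorem toComplex_sub (x y : Plane) : toComplex (x - y) = toComplex x - toComplex y :=
  map_sub Complex.orthonormalBasisOneI.repr.symm x y

theorem toComplex_smul (c : ℝ) (x : Plane) : toComplex (c • x) = c * toComplex x := by
  rw [← Complex.real_smul]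
  exact map_smul Complex.orthonormalBasisOneI.repr.symm c x

theorem norm_toComplex (x : Plane) : ‖toComplex x‖ = ‖x‖ :=
  Complex.orthonormalBasisOneI.repr.symm.norm_map x

theorem toComplex_inj {x y : Plane} : toComplex x = toComplex y ↔ x = y :=
  Complex.orthonormalBasisOneI.repr.symm.injective.eq_iff

namespace MixedGraph

variable {V : Type*}

/-- `(G, P)` is infinitesimally rigid. -/
def InfinitesimallyRigid (G : MixedGraph V) (P : V → ℂ) : Prop :=
  ∀ u : V → ℂ, (∀ e ∈ G.edges, constraint P e u = 0) → ∀ x y, u x = u y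

theorem continuous_constraint (e : MixedEdge V) :
    Continuous fun x : (V → ℂ) × (V → ℂ) => constraint x.1 e x.2 := by
  obtain ⟨a, b, hab⟩ := exists_ends_eq e
  simp_rw [constraint_apply hab]
  fun_prop

theorem InfinitesimallyRigid.eventually [Finite V] {G : MixedGraph V} {P : V → ℂ}
    (h : G.InfinitesimallyRigid P) : ∀ᶠ Q in 𝓝 P, G.InfinitesimallyRigid Q := by
  have := Fintype.ofFinite V
  rcases isEmpty_or_nonempty V with hV | ⟨⟨x₀⟩⟩
  · exact Eventually.of_forall fun _ _ _ x => isEmptyElim x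
  -- Translations are removed by normalising `u x₀ = 0`; on the compact unit sphere the
  -- non-vanishing of some constraint or of `u x₀` persists for all `Q` near `P`.
  have key := (isCompact_sphere (0 : V → ℂ) 1).eventually_forall_of_forall_eventually (x₀ := P)
    (P := fun Q u => (∃ e ∈ G.edges, constraint Q e u ≠ 0) ∨ u x₀ ≠ 0) ?_
  · filter_upwards [key] with Q hQ u hu
    suffices ∀ u : V → ℂ, (∀ e ∈ G.edges, constraint Q e u = 0) → u x₀ = 0 → u = 0 by
      have h0 := this (fun x => u x - u x₀) (fun e he => ?_) (sub_self _)
      · intro x y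
        have hx := congrFun h0 x
        have hy := congrFun h0 y
        simp only [Pi.zero_apply, sub_eq_zero] at hx hy
        rw [hx, hy]
      · rw [← hu e he]
        exact constraint_congr fun x _ y _ => ⟨rfl, sub_sub_sub_cancel_right _ _ _⟩
    intro u hu hx₀
    by_contra hne
    have hnorm : ‖u‖ ≠ 0 := norm_ne_zero_iff.2 hne
    rcases hQ (‖u‖⁻¹ • u) (by simp [norm_smul, hnorm]) with ⟨e, he, hne⟩ | hne
    · rw [map_smul, hu e he, smul_zero] at hne
      exact hne rfl
    · rw [Pi.smul_apply, hx₀, smul_zero] at hne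
      exact hne rfl
  · intro u hu
    by_cases hex : ∃ e ∈ G.edges, constraint P e u ≠ 0
    · obtain ⟨e, he, hne⟩ := hex
      filter_upwards [(continuous_constraint e).continuousAt.eventually_ne (x := (P, u)) hne]
        with z hz
      exact Or.inl ⟨e, he, hz⟩
    · push Not at hex
      have hne : u x₀ ≠ 0 := by
        intro h0
        have : u = 0 := funext fun y => (h u hex y x₀).trans h0
        simp [this] at hu
      have hc : Continuous fun z : (V → ℂ) × (V → ℂ) => z.2 x₀ := by fun_prop
      filter_upwards [hc.continuousAt.eventually_ne (x := (P, u)) hne] with z hz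
      exact Or.inr hz

/-- Averaging: if `p` and `q` are equivalent, then `p - q` is an infinitesimal motion at the
midpoint `(p + q) / 2`, because `|A|² - |B|² = Re((A + B) * conj(A - B))` and parallel `A`, `B` have
parallel sum and difference. For `q` near `p` the midpoint is still infinitesimally rigid, so `p -
q` is constant. -/
theorem InfinitesimallyRigid.frameworkRigid [Finite V] {G : MixedGraph V} {p : V → Plane}
    (h : G.InfinitesimallyRigid (toComplex ∘ p)) : G.FrameworkRigid p := by
  have := Fintype.ofFinite V
  obtain ⟨ε, hε, hball⟩ := Metric.eventually_nhds_iff.1 h.eventually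
  refine ⟨ε, hε, fun q hq hpq => Or.inl ?_⟩
  set P := toComplex ∘ p with hP
  set Q := toComplex ∘ q with hQ
  have hPsub : ∀ a b, P a - P b = toComplex (p a - p b) := fun a b => (toComplex_sub _ _).symm
  have hQsub : ∀ a b, Q a - Q b = toComplex (q a - q b) := fun a b => (toComplex_sub _ _).symm
  have hrig := @hball (fun v => (P v + Q v) / 2) (by
    rw [dist_pi_lt_iff hε]
    intro v
    rw [dist_eq_norm, show (P v + Q v) / 2 - P v = -((P v - Q v) / 2) by ring, norm_neg, norm_div,
      hP, hQ, Function.comp, Function.comp, ← toComplex_sub, norm_toComplex]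
    have := hpq v
    have := norm_nonneg (p v - q v)
    simp only [Complex.norm_ofNat]
    linarith)
  have hu := hrig (fun v => P v - Q v) ?_
  · intro u v
    have := hu u v
    rw [← toComplex_inj, ← hPsub, ← hQsub]
    linear_combination this
  · intro e he
    obtain ⟨a, b, hab⟩ := exists_ends_eq e
    rw [constraint_apply hab, show (P a + Q a) / 2 - (P b + Q b) / 2 =
      ((1 / 2 : ℝ) : ℂ) * ((P a - P b) + (Q a - Q b)) by push_cast; ring,
      show P a - Q a - (P b - Q b) = (P a - P b) - (Q a - Q b) by ring]
    have hre : ∀ (τ A B : ℂ), (τ * (((1 / 2 : ℝ) : ℂ) * (A + B)) * conj (A - B)).re =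
        1 / 2 * (τ * ((A + B) * conj (A - B))).re := by
      intro τ A B
      rw [← Complex.re_ofReal_mul]; congr 1; ring
    rw [hre]
    rcases he with ⟨s, hs, rfl⟩ | ⟨s, hs, rfl⟩
    · have hs' : s = s(a, b) := hab
      subst hs'
      have hpar := hq.1 a b hs
      rw [unit_inl]
      by_cases hqab : q a = q b
      · have hz : Q a - Q b = 0 := by simp [hQ, hqab]
        rw [hz, add_zero, sub_zero, Complex.mul_conj]
        simp
      · obtain ⟨c, hc⟩ := hpar hqab
        have hc' : P a - P b = c * (Q a - Q b) := by
          rw [hPsub, hQsub, hc, toComplex_smul]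
        rw [hc', show (c * (Q a - Q b) + (Q a - Q b)) * conj (c * (Q a - Q b) - (Q a - Q b)) =
          (((c + 1) * (c - 1) : ℝ) : ℂ) * ((Q a - Q b) * conj (Q a - Q b)) by
          simp only [map_sub, map_mul, Complex.conj_ofReal]; push_cast; ring, Complex.mul_conj,
          ← Complex.ofReal_mul]
        simp
    · have hs' : s = s(a, b) := hab
      subst hs'
      have hlen := hq.2 a b hs
      rw [← norm_toComplex, ← norm_toComplex, ← hPsub, ← hQsub] at hlen
      rw [unit_inr, one_mul]
      have hsq : Complex.normSq (P a - P b) = Complex.normSq (Q a - Q b) := by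
        rw [Complex.normSq_eq_norm_sq, Complex.normSq_eq_norm_sq, hlen]
      generalize P a - P b = A at hsq ⊢
      generalize Q a - Q b = B at hsq ⊢
      simp [Complex.normSq_apply] at hsq ⊢
      linarith

theorem continuous_row_ofComplex (e : MixedEdge V) (x : V × Fin 2) :
    Continuous fun m : V → ℂ => row (fun v => ofComplex (m v)) e x := by
  obtain ⟨Q, hQ⟩ := exists_aeval_eq_row e x
  simp_rw [← hQ]
  have hc : Continuous fun m : V → ℂ => fun y : V × Fin 2 => ofComplex (m y.1) y.2 := by
    refine continuous_pi fun y => ?_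
    have : Continuous fun m : V → ℂ => ofComplex (m y.1) :=
      Complex.orthonormalBasisOneI.repr.continuous.comp (continuous_apply y.1)
    fun_prop
  simp_rw [MvPolynomial.aeval_def, ← MvPolynomial.eval_map]
  exact (MvPolynomial.continuous_eval _).comp hc

theorem eventually_linearIndepOn_constraint [Finite V] {P : V → ℂ} {B : Set (MixedEdge V)}
    (hB : LinearIndepOn ℝ (constraint P) B) :
    ∀ᶠ Q in 𝓝 P, LinearIndepOn ℝ (constraint Q) B := by
  have := Fintype.ofFinite V
  have hiff : ∀ Q : V → ℂ, LinearIndepOn ℝ (constraint Q) B ↔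
      LinearIndependent ℝ fun b : B => row (fun v => ofComplex (Q v)) b := by
    intro Q
    have hQ : Q = toComplex ∘ fun v => ofComplex (Q v) :=
      funext fun v => (toComplex_ofComplex _).symm
    conv_lhs => rw [hQ]
    rw [← linearIndepOn_row_iff]
    rfl
  simp_rw [hiff] at hB ⊢
  have hc : Continuous fun Q : V → ℂ => fun b : B => row (fun v => ofComplex (Q v)) b :=
    continuous_pi fun b => continuous_pi fun x => continuous_row_ofComplex _ _
  exact hc.continuousAt.eventually (LinearIndependent.eventually hB)

theorem exists_forall_constraint_eq [Finite V] {P : V → ℂ} {B : Set (MixedEdge V)}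
    (hB : LinearIndepOn ℝ (constraint P) B) (g : B → ℝ) :
    ∃ u : V → ℂ, ∀ b : B, constraint P b u = g b := by
  have := Fintype.ofFinite B
  classical
  have h1 : ∀ b : B, ∃ u : V → ℂ, constraint P b u = 1 ∧
      ∀ f : B, f ≠ b → constraint P f u = 0 := by
    intro b
    have hb : insert (b : MixedEdge V) (B \ {(b : MixedEdge V)}) = B := by
      rw [Set.insert_sdiff_singleton, Set.insert_eq_of_mem b.2]
    rw [← hb] at hB
    obtain ⟨u, hu, hne⟩ := exists_apply_ne_zero_of_linearIndepOn_insert (fun h => h.2 rfl) hB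
    refine ⟨(constraint P b u)⁻¹ • u, ?_, fun f hf => ?_⟩
    · rw [map_smul, smul_eq_mul, inv_mul_cancel₀ hne]
    · rw [map_smul, hu f ⟨f.2, fun h => hf (Subtype.ext h)⟩, smul_zero]
  choose w hw hw' using h1
  refine ⟨∑ b, g b • w b, fun b => ?_⟩
  rw [map_sum, Finset.sum_eq_single b]
  · rw [map_smul, hw, smul_eq_mul, mul_one]
  · intro f _ hf
    rw [map_smul, hw' f b hf.symm, smul_zero]
  · simp

/-- This finds a small `u` that is a motion at `P - u`, so that `P` and `P - 2u` can be compared by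
averaging. The equations differ from those at `P` by a quadratic term only, so the derivative at `0`
is onto by independence of `B`, and the map is open there. The extra coordinate `l` keeps `u` from
being constant. -/
theorem exists_small_motion [Finite V] {P : V → ℂ} {B : Set (MixedEdge V)}
    (hB : LinearIndepOn ℝ (constraint P) B) {u₀ : V → ℂ} (hu₀ : ∀ b ∈ B, constraint P b u₀ = 0)
    {x y : V} (hxy : u₀ x ≠ u₀ y) {S : Set (V → ℂ)} (hS : S ∈ 𝓝 0) :
    ∃ u ∈ S, (∀ b ∈ B, constraint (P - u) b u = 0) ∧ u x ≠ u y := by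
  have := Fintype.ofFinite V
  have := Fintype.ofFinite B
  let c := u₀ x - u₀ y
  let l : (V → ℂ) →ₗ[ℝ] ℝ :=
    { toFun := fun u => ((u x - u y) * conj c).re
      map_add' := fun u v => by
        rw [← Complex.add_re]; congr 1; simp only [Pi.add_apply]; ring
      map_smul' := fun r u => by
        simp; ring }
  have hl₀ : l u₀ ≠ 0 := by
    change (c * conj c).re ≠ 0
    rw [Complex.mul_conj, Complex.ofReal_re]
    exact (Complex.normSq_pos.2 (sub_ne_zero.2 hxy)).ne'
  let H : (V → ℂ) → (B → ℝ) × ℝ := fun u => (fun b => constraint (P - u) b u, l u)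
  let H' : (V → ℂ) →L[ℝ] (B → ℝ) × ℝ :=
    (ContinuousLinearMap.pi fun b : B => (constraint P (b : MixedEdge V)).toContinuousLinearMap).prod
      l.toContinuousLinearMap
  have hH : HasStrictFDerivAt H H' 0 := by
    refine HasStrictFDerivAt.prodMk ?_ l.toContinuousLinearMap.hasStrictFDerivAt
    refine hasStrictFDerivAt_pi.2 fun b => ?_
    obtain ⟨a, a', hab⟩ := exists_ends_eq (b : MixedEdge V)
    have heq : (fun u : V → ℂ => constraint (P - u) b u) = fun u =>
        (constraint P (b : MixedEdge V)).toContinuousLinearMap u -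
          (b : MixedEdge V).unit.re * ‖u a - u a'‖ ^ 2 := by
      funext u
      rw [LinearMap.coe_toContinuousLinearMap', constraint_apply hab, constraint_apply hab,
        ← Complex.normSq_eq_norm_sq]
      simp [Complex.normSq_apply]
      ring
    rw [heq]
    have h1 : HasStrictFDerivAt (fun u : V → ℂ => u a - u a')
        (ContinuousLinearMap.proj (R := ℝ) a - ContinuousLinearMap.proj a') 0 :=
      (ContinuousLinearMap.proj (R := ℝ) (φ := fun _ : V => ℂ) a -
        ContinuousLinearMap.proj a').hasStrictFDerivAt
    have h1' : HasStrictFDerivAt (fun u : V → ℂ => ‖u a - u a'‖ ^ 2)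
        (0 : (V → ℂ) →L[ℝ] ℝ) 0 := by
      have hd : ContDiff ℝ 1 fun u : V → ℂ => ‖u a - u a'‖ ^ 2 :=
        ContDiff.norm_sq ℝ (by fun_prop)
      refine hd.contDiffAt.hasStrictFDerivAt' ?_ one_ne_zero
      simpa using h1.hasFDerivAt.norm_sq
    have h2 := h1'.const_mul ((b : MixedEdge V).unit.re)
    have h3 := ((constraint P (b : MixedEdge V)).toContinuousLinearMap.hasStrictFDerivAt
      (x := (0 : V → ℂ))).sub h2
    rw [smul_zero, sub_zero] at h3
    exact h3
  have hsurj : H'.range = ⊤ := by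
    rw [LinearMap.range_eq_top]
    rintro ⟨g, s⟩
    obtain ⟨u, hu⟩ := exists_forall_constraint_eq hB g
    refine ⟨u + ((s - l u) / l u₀) • u₀, Prod.ext (funext fun b => ?_) ?_⟩
    · change constraint P b (u + _) = g b
      rw [map_add, map_smul, hu₀ b b.2, smul_zero, add_zero, hu]
    · change l (u + _) = s
      rw [map_add, map_smul, smul_eq_mul, div_mul_cancel₀ _ hl₀]
      ring
  have hmap := hH.map_nhds_eq_of_surj hsurj
  have hH0 : H 0 = (0, 0) := Prod.ext (funext fun b => map_zero _) (map_zero l)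
  have himg : H '' S ∈ 𝓝 ((0, 0) : (B → ℝ) × ℝ) := by
    rw [← hH0, ← hmap]
    exact image_mem_map hS
  have hc : Continuous fun s : ℝ => ((0, s) : (B → ℝ) × ℝ) := by fun_prop
  have hev : ∀ᶠ s in 𝓝[≠] (0 : ℝ), ((0, s) : (B → ℝ) × ℝ) ∈ H '' S :=
    Filter.Eventually.filter_mono nhdsWithin_le_nhds (hc.tendsto 0 himg)
  obtain ⟨s, ⟨u, huS, hu⟩, hs⟩ := (hev.and self_mem_nhdsWithin).exists
  refine ⟨u, huS, fun b hb => congrFun (congrArg Prod.fst hu) ⟨b, hb⟩, fun h => hs ?_⟩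
  have h2 : l u = s := congrArg Prod.snd hu
  rw [← h2]
  change ((u x - u y) * conj c).re = 0
  rw [h, sub_self, zero_mul, Complex.zero_re]

/-- Averaging in reverse: a small motion `u` at `m = P - u` makes `m + u = P` and `m - u`
equivalent. They are not congruent, as `u x ≠ u y` and `m x ≠ m y`. -/
theorem FrameworkRigid.infinitesimallyRigid [Finite V] {G : MixedGraph V} {p : V → Plane}
    (hp : IsGeneric p) (h : G.FrameworkRigid p) : G.InfinitesimallyRigid (toComplex ∘ p) := by
  have := Fintype.ofFinite V
  intro u₀ hu₀ x y
  by_contra hxy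
  obtain ⟨ε, hε, hrig⟩ := h
  set P := toComplex ∘ p with hP
  obtain ⟨B, hBE, -, hspan, hB⟩ :=
    exists_linearIndepOn_extension (linearIndepOn_empty ℝ (constraint P)) (Set.empty_subset G.edges)
  have hPxy : P x ≠ P y := hp.genericConfig.injective.ne fun h => hxy (h ▸ rfl)
  have hcont : Tendsto (fun u : V → ℂ => P - u) (𝓝 0) (𝓝 P) := by
    have : Continuous fun u : V → ℂ => P - u := by fun_prop
    simpa using this.tendsto 0
  have hball : ∀ᶠ u : V → ℂ in 𝓝 0, ‖u‖ < ε / 2 := by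
    have := Metric.ball_mem_nhds (0 : V → ℂ) (half_pos hε)
    filter_upwards [this] with u hu
    simpa using hu
  have hne : ∀ᶠ Q : V → ℂ in 𝓝 P, Q x - Q y ≠ 0 :=
    (Continuous.continuousAt (by fun_prop)).eventually_ne (sub_ne_zero.2 hPxy)
  have hS := (hball.and (hcont.eventually (hne.and (eventually_linearIndepOn_constraint hB))))
  obtain ⟨u, ⟨hsmall, hmxy, hBm⟩, hmot, huxy⟩ :=
    exists_small_motion hB (fun b hb => hu₀ b (hBE hb)) hxy hS
  set m := P - u with hm
  have hmotE : ∀ e ∈ G.edges, constraint m e u = 0 := by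
    intro e he
    by_cases heB : e ∈ B
    · exact hmot e heB
    -- The basis `B` at `P` stays independent at the nearby `m`, and no larger set can become
    -- independent there because `P` is generic. So the other edges follow from `B` at `m` too.
    · refine apply_eq_zero_of_not_linearIndepOn_insert hBm (fun hind => ?_) hmot
      have h1 := ((linearIndepOn_insert heB).1 (hp.genericConfig.indep _ _ hind)).2
      exact h1 (hspan ⟨e, he, rfl⟩)
  set q : V → Plane := fun v => ofComplex (m v - u v) with hq
  have hPm : ∀ a b, toComplex (p a - p b) = (m a - m b) + (u a - u b) := by
    intro a b
    rw [toComplex_sub, hm]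
    simp only [hP, Pi.sub_apply, Function.comp]
    ring
  have hQm : ∀ a b, toComplex (q a - q b) = (m a - m b) - (u a - u b) := by
    intro a b
    rw [toComplex_sub, hq, toComplex_ofComplex, toComplex_ofComplex]
    ring
  have heq : G.Equivalent p q := by
    constructor
    · intro a b hab hqab
      have hc := hmotE (Sum.inl s(a, b)) (Or.inl ⟨_, hab, rfl⟩)
      rw [constraint_apply (a := a) (b := b) rfl, unit_inl] at hc
      have hq0 : toComplex (q a - q b) ≠ 0 := by
        rw [toComplex_sub, sub_ne_zero]
        exact fun h => hqab (toComplex_inj.1 h)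
      rw [hQm] at hq0
      refine ⟨(((m a - m b) + (u a - u b)) * conj ((m a - m b) - (u a - u b))).re /
        Complex.normSq ((m a - m b) - (u a - u b)), ?_⟩
      rw [← toComplex_inj, toComplex_smul, hPm, hQm]
      set M := m a - m b
      set U := u a - u b
      have him : ((M + U) * conj (M - U)).im = 0 := by
        simp at hc ⊢
        linarith
      have hreal : (((M + U) * conj (M - U)).re : ℂ) = (M + U) * conj (M - U) := by
        apply Complex.ext
        · rw [Complex.ofReal_re]
        · rw [Complex.ofReal_im, him]
      have hconj : conj (M - U) ≠ 0 := (map_ne_zero _).2 hq0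
      rw [Complex.ofReal_div, hreal, ← Complex.mul_conj]
      field_simp
    · intro a b hab
      have hc := hmotE (Sum.inr s(a, b)) (Or.inr ⟨_, hab, rfl⟩)
      rw [constraint_apply (a := a) (b := b) rfl, unit_inr, one_mul] at hc
      rw [← norm_toComplex, ← norm_toComplex, hPm, hQm]
      set M := m a - m b
      set U := u a - u b
      rw [Complex.norm_def, Complex.norm_def]
      congr 1
      simp [Complex.normSq_apply] at hc ⊢
      linarith
  have hclose : ∀ v, ‖p v - q v‖ < ε := by
    intro v
    rw [← norm_toComplex, toComplex_sub, hq, toComplex_ofComplex]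
    have hv : toComplex (p v) - (m v - u v) = 2 * u v := by
      rw [hm]; simp only [hP, Pi.sub_apply, Function.comp]; ring
    rw [hv, norm_mul, Complex.norm_ofNat]
    have := norm_le_pi_norm u v
    linarith
  rcases hrig q heq hclose with hcong | hcong
  · have h1 := congrArg toComplex (hcong x y)
    rw [hPm, hQm] at h1
    exact huxy (sub_eq_zero.1 (by linear_combination h1 / 2))
  · have h1 := congrArg toComplex (hcong x y)
    rw [hPm, hQm] at h1
    exact hmxy (by linear_combination h1 / 2)

end MixedGraph

/-! ### From M-connectedness to redundant rigidity. -/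

namespace MixedEdge

variable {V : Type*} {P : V → ℂ}

theorem unit_ne_of_isDir {e f : MixedEdge V} (he : e.IsDir) (hf : ¬ f.IsDir) : e.unit ≠ f.unit := by
  obtain ⟨s, rfl⟩ := he
  rcases f with t | t
  · exact absurd ⟨t, rfl⟩ hf
  · simp [unit, Complex.ext_iff]

/-- A motion of a circuit with edges of both kinds is constant. -/
theorem eq_of_isMinDep [Finite V] (hP : GenericConfig P) {C : Set (MixedEdge V)}
    (hC : IsMinDep (constraint P) C) (hdiag : ∀ e ∈ C, ¬ e.ends.IsDiag) {e f : MixedEdge V}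
    (he : e ∈ C) (hf : f ∈ C) (hed : e.IsDir) (hfd : ¬ f.IsDir) {u : V → ℂ}
    (hu : ∀ g ∈ C, constraint P g u = 0) {x y : V} (hx : x ∈ verts C) (hy : y ∈ verts C) :
    u x = u y := by
  obtain ⟨t, z, h⟩ := hP.exists_affine_of_isMinDep hC hdiag u hu
  have hre : ∀ g ∈ C, (g.unit * conj z).re = 0 := by
    intro g hg
    obtain ⟨a, b, hab⟩ := exists_ends_eq g
    have hne : a ≠ b := by
      have := hdiag g hg
      rwa [hab, Sym2.mk_isDiag_iff] at this
    exact re_unit_mul_conj_eq_zero hP.injective hab hne (h a (mem_verts_left hg hab))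
      (h b (mem_verts_right hg hab)) (hu g hg)
  have hz := eq_zero_of_re_unit_mul (unit_ne_of_isDir hed hfd) (hre e he) (hre f hf)
  rw [h x hx, h y hy, hz, zero_mul, zero_mul]

end MixedEdge

namespace MixedGraph

variable {V : Type*} {G : MixedGraph V}

theorem adj_iff_exists_mem_edges {a b : V} :
    (G.D ⊔ G.L).Adj a b ↔ ∃ e ∈ G.edges, e.ends = s(a, b) := by
  constructor
  · rintro (h | h)
    · exact ⟨Sum.inl s(a, b), Or.inl ⟨_, h, rfl⟩, rfl⟩
    · exact ⟨Sum.inr s(a, b), Or.inr ⟨_, h, rfl⟩, rfl⟩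
  · rintro ⟨e, ⟨s, hs, rfl⟩ | ⟨s, hs, rfl⟩, h⟩
    · have : s = s(a, b) := h
      subst this
      exact Or.inl hs
    · have : s = s(a, b) := h
      subst this
      exact Or.inr hs

theorem inl_mem_edges {s : Sym2 V} : (Sum.inl s : MixedEdge V) ∈ G.edges ↔ s ∈ G.D.edgeSet := by
  simp [edges]

theorem inr_mem_edges {s : Sym2 V} : (Sum.inr s : MixedEdge V) ∈ G.edges ↔ s ∈ G.L.edgeSet := by
  simp [edges]

theorem exists_not_isDir_of_isCircuit [Finite V] (hirr : G.DirectionIrreducible) {p : V → Plane}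
    (hp : IsGeneric p) {C : Set (MixedEdge V)} (hCE : C ⊆ G.edges)
    (hC : IsMinDep (constraint (toComplex ∘ p)) C) : ∃ f ∈ C, ¬ f.IsDir := by
  by_contra! hcon
  obtain ⟨e, he⟩ := hC.nonempty
  refine hirr.1 ⟨e, hcon e he, C, ?_, he, hcon⟩
  rw [G.rigidityMatroid_eq hp, frameworkMatroid_isCircuit]
  exact ⟨hCE, hC⟩

theorem TwoConnected.nontrivial [Finite V] (h : G.TwoConnected) : Nontrivial V :=
  Finite.one_lt_card_iff_nontrivial.1 (by have := h.1; omega)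

theorem TwoConnected.exists_mem_edges [Finite V] (h : G.TwoConnected) (x : V) :
    ∃ e ∈ G.edges, x ∈ e.ends := by
  have := h.nontrivial
  obtain ⟨y, hy⟩ := h.2.1.preconnected.exists_adj_of_nontrivial x
  obtain ⟨e, he, hends⟩ := adj_iff_exists_mem_edges.1 hy
  exact ⟨e, he, hends ▸ Sym2.mem_mk_left _ _⟩

/-- Every edge shares a circuit with a fixed direction edge `d`, and that circuit also has a length
edge. So all motions of `G` agree with their value at `a` on every such circuit, and deleting one
edge of `G` leaves the motions unchanged. -/
theorem MConnected.redundantlyRigid [Finite V] (hD : G.D ≠ ⊥) (hirr : G.DirectionIrreducible)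
    (hconn : G.TwoConnected) (hM : G.MConnected) : G.RedundantlyRigid := by
  obtain ⟨p, hp⟩ := exists_isGeneric V
  refine ⟨p, hp, ?_⟩
  have hP := hp.genericConfig
  set P := toComplex ∘ p with hPdef
  have hcirc : ∀ e ∈ G.edges, ∀ f ∈ G.edges, e ≠ f →
      ∃ C ⊆ G.edges, IsMinDep (constraint P) C ∧ e ∈ C ∧ f ∈ C := by
    intro e he f hf hef
    unfold MConnected at hM
    rw [G.rigidityMatroid_eq hp] at hM
    obtain ⟨C, hC, heC, hfC⟩ := hM e he f hf hef
    rw [frameworkMatroid_isCircuit] at hC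
    exact ⟨C, hC.1, hC.2, heC, hfC⟩
  obtain ⟨a, b, hab⟩ := SimpleGraph.ne_bot_iff_exists_adj.1 hD
  set d : MixedEdge V := Sum.inl s(a, b) with hd
  have hdE : d ∈ G.edges := inl_mem_edges.2 hab
  -- A third vertex supplies an edge other than `d`, needed because connectivity of the matroid
  -- yields circuits only through two distinct edges.
  obtain ⟨x, hxa, hxb⟩ : ∃ x, x ≠ a ∧ x ≠ b := by
    by_contra! hcon
    have h3 := hconn.1
    have : (Set.univ : Set V) ⊆ {a, b} := fun x _ => by
      by_cases hx : x = a
      · exact Or.inl hx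
      · exact Or.inr (hcon x hx)
    have h1 := Set.ncard_le_ncard this (Set.toFinite _)
    have h2 := Set.ncard_insert_le a {b}
    rw [Set.ncard_univ] at h1
    rw [Set.ncard_singleton] at h2
    omega
  obtain ⟨f, hf, hxf⟩ := hconn.exists_mem_edges x
  have hfd : f ≠ d := by
    rintro rfl
    rcases Sym2.mem_iff.1 hxf with h | h
    · exact hxa h
    · exact hxb h
  have hthrough : ∀ e ∈ G.edges, ∃ C ⊆ G.edges, IsMinDep (constraint P) C ∧ d ∈ C ∧ e ∈ C := by
    intro e he
    by_cases hed : e = d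
    · obtain ⟨C, hCE, hC, hdC, -⟩ := hcirc d hdE f hf hfd.symm
      exact ⟨C, hCE, hC, hdC, hed ▸ hdC⟩
    · exact hcirc d hdE e he (Ne.symm hed)
  intro e he
  refine InfinitesimallyRigid.frameworkRigid fun u hu => ?_
  rw [edges_deleteEdge] at hu
  have huE : ∀ g ∈ G.edges, constraint P g u = 0 := by
    intro g hg
    by_cases hge : g = e
    · obtain ⟨C, hCE, hC, -, heC⟩ := hthrough e he
      rw [hge]
      exact hC.apply_eq_zero heC fun g' hg' hne => hu g' ⟨hCE hg', hne⟩
    · exact hu g ⟨hg, hge⟩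
  suffices ∀ x, u x = u a from fun x y => (this x).trans (this y).symm
  intro x
  obtain ⟨g, hg, hxg⟩ := hconn.exists_mem_edges x
  obtain ⟨C, hCE, hC, hdC, hgC⟩ := hthrough g hg
  obtain ⟨l, hl, hld⟩ := exists_not_isDir_of_isCircuit hirr hp hCE hC
  exact eq_of_isMinDep hP hC (fun e he => not_isDiag_of_mem_edges (hCE he)) hdC hl ⟨_, rfl⟩ hld
    (fun g hg => huE g (hCE hg)) ⟨g, hgC, hxg⟩ (mem_verts_left hdC (a := a) (b := b) rfl)

end MixedGraph

/-! ### Ranks and vertices of attachment of the matroid components. -/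

namespace MixedEdge

variable {V : Type*} {P : V → ℂ}

/-- If all motions of `S` are constant on `Y`, then `S` has at least `2|Y| - 2` elements. -/
theorem two_mul_ncard_le [Finite V] {S : Set (MixedEdge V)} {Y : Set V}
    (h : ∀ u : V → ℂ, (∀ e ∈ S, constraint P e u = 0) → ∀ x ∈ Y, ∀ y ∈ Y, u x = u y) :
    2 * Y.ncard ≤ S.ncard + 2 := by
  have := Fintype.ofFinite V
  have := Fintype.ofFinite S
  have := Fintype.ofFinite Y
  rcases Y.eq_empty_or_nonempty with rfl | ⟨y₀, hy₀⟩
  · simp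
  -- On vectors supported on `Y`, the constraints of `S` together with the value at `y₀` determine
  -- the vector.
  let Ψ : (Y → ℂ) →ₗ[ℝ] (S → ℝ) × ℂ :=
    (LinearMap.pi fun e : S => constraint P (e : MixedEdge V) ∘ₗ extendZero Y).prod
      (LinearMap.proj (R := ℝ) (⟨y₀, hy₀⟩ : Y))
  have hinj : Function.Injective Ψ := by
    rw [injective_iff_map_eq_zero]
    intro w hw
    have h1 : ∀ e ∈ S, constraint P e (extendZero Y w) = 0 := fun e he =>
      congrFun (congrArg Prod.fst hw) ⟨e, he⟩
    have h2 : w ⟨y₀, hy₀⟩ = 0 := congrArg Prod.snd hw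
    funext ⟨y, hy⟩
    have := h _ h1 y hy y₀ hy₀
    rw [extendZero_of_mem _ hy, extendZero_of_mem _ hy₀, h2] at this
    exact this
  have hle := LinearMap.finrank_le_finrank_of_injective hinj
  rw [Module.finrank_prod, Module.finrank_pi_fintype, Module.finrank_pi_fintype] at hle
  simp only [Complex.finrank_real_complex, Finset.sum_const, Finset.card_univ, smul_eq_mul,
    Module.finrank_self, mul_one] at hle
  rw [← Nat.card_eq_fintype_card, ← Nat.card_eq_fintype_card, Nat.card_coe_set_eq,
    Nat.card_coe_set_eq] at hle
  omega

end MixedEdge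

/-- `K` is a connected component of the rigidity matroid with edge set `E` at `P`, and it is not a
single coloop. -/
structure IsCircuitClass {V : Type*} (P : V → ℂ) (E K : Set (MixedEdge V)) : Prop where
  subset : K ⊆ E
  nonempty : K.Nonempty
  circuit_subset : ∀ C ⊆ E, IsMinDep (constraint P) C → ∀ e ∈ K, e ∈ C → C ⊆ K
  exists_circuit : ∀ e ∈ K, ∀ f ∈ K, ∃ C, IsMinDep (constraint P) C ∧ e ∈ C ∧ f ∈ C ∧ C ⊆ K

namespace IsCircuitClass

variable {V : Type*} {P : V → ℂ} {E K : Set (MixedEdge V)}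

/-- All circuits through a fixed edge `e` share its two end vertices, and a similarity motion is
determined by its values at two points. -/
theorem exists_affine [Finite V] (hK : IsCircuitClass P E K) (hP : GenericConfig P)
    (hdiag : ∀ e ∈ E, ¬ e.ends.IsDiag) {u : V → ℂ} (hu : ∀ e ∈ K, constraint P e u = 0) :
    ∃ t z : ℂ, (∀ x ∈ verts K, u x = t + z * P x) ∧ ∀ e ∈ K, (e.unit * conj z).re = 0 := by
  obtain ⟨e, he⟩ := hK.nonempty
  obtain ⟨a, b, hab⟩ := exists_ends_eq e
  have hne : ∀ {e : MixedEdge V} {a b : V}, e ∈ K → e.ends = s(a, b) → a ≠ b := by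
    intro e a b he hab
    have := hdiag e (hK.subset he)
    rwa [hab, Sym2.mk_isDiag_iff] at this
  obtain ⟨t, z, hta, htb⟩ := exists_affine_pair hP.injective (hne he hab) u
  have hall : ∀ x ∈ verts K, u x = t + z * P x := by
    rintro x ⟨f, hf, hx⟩
    obtain ⟨C, hC, heC, hfC, hCK⟩ := hK.exists_circuit e he f hf
    obtain ⟨t', z', h⟩ := hP.exists_affine_of_isMinDep hC (fun g hg => hdiag g (hK.subset (hCK hg)))
      u fun g hg => hu g (hCK hg)
    obtain ⟨rfl, rfl⟩ := affine_unique hP.injective (hne he hab) hta htb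
      (h a (mem_verts_left heC hab)) (h b (mem_verts_right heC hab))
    exact h x ⟨f, hfC, hx⟩
  refine ⟨t, z, hall, fun f hf => ?_⟩
  obtain ⟨c, d, hcd⟩ := exists_ends_eq f
  exact re_unit_mul_conj_eq_zero hP.injective hcd (hne hf hcd) (hall c (mem_verts_left hf hcd))
    (hall d (mem_verts_right hf hcd)) (hu f hf)

open Classical in
/-- A lower bound on the rank of a component. -/
theorem exists_linearIndepOn [Finite V] (hK : IsCircuitClass P E K) (hP : GenericConfig P)
    (hdiag : ∀ e ∈ E, ¬ e.ends.IsDiag) (hlen : ∃ e ∈ K, ¬ e.IsDir) :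
    ∃ B ⊆ K, LinearIndepOn ℝ (constraint P) B ∧
      2 * (verts K).ncard ≤ B.ncard + if ∃ e ∈ K, e.IsDir then 2 else 3 := by
  obtain ⟨B, hBK, -, hspan, hB⟩ :=
    exists_linearIndepOn_extension (linearIndepOn_empty ℝ (constraint P)) (Set.empty_subset K)
  have hmot : ∀ u : V → ℂ, (∀ e ∈ B, constraint P e u = 0) → ∀ e ∈ K, constraint P e u = 0 :=
    fun u hu e he => (mem_span_image_iff_forall_apply_eq_zero _ _ _).1 (hspan ⟨e, he, rfl⟩) u hu
  refine ⟨B, hBK, hB, ?_⟩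
  obtain ⟨l, hl, hld⟩ := hlen
  split_ifs with hdir
  · obtain ⟨d, hd, hdd⟩ := hdir
    refine two_mul_ncard_le (P := P) fun u hu x hx y hy => ?_
    obtain ⟨t, z, h, hz⟩ := hK.exists_affine hP hdiag (hmot u hu)
    have hz0 := eq_zero_of_re_unit_mul (unit_ne_of_isDir hdd hld) (hz d hd) (hz l hl)
    rw [h x hx, h y hy, hz0, zero_mul, zero_mul]
  · obtain ⟨a, b, hab⟩ := exists_ends_eq l
    have hne : a ≠ b := by
      have := hdiag l (hK.subset hl)
      rwa [hab, Sym2.mk_isDiag_iff] at this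
    -- Without direction edges rotations survive. One auxiliary direction edge parallel to `l` kills
    -- them, at the cost of one in the count.
    have := two_mul_ncard_le (P := P) (S := insert (Sum.inl s(a, b)) B) (Y := verts K)
      fun u hu x hx y hy => by
        obtain ⟨t, z, h, hz⟩ := hK.exists_affine hP hdiag
          (hmot u fun e he => hu e (Set.mem_insert_of_mem _ he))
        have hd := re_unit_mul_conj_eq_zero (e := Sum.inl s(a, b)) hP.injective rfl hne
          (h a (mem_verts_left hl hab)) (h b (mem_verts_right hl hab)) (hu _ (Set.mem_insert _ _))
        have hz0 := eq_zero_of_re_unit_mul (unit_ne_of_isDir ⟨s(a, b), rfl⟩ hld) hd (hz l hl)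
        rw [h x hx, h y hy, hz0, zero_mul, zero_mul]
    have h2 := Set.ncard_insert_le (Sum.inl s(a, b)) B
    omega

/-- A vertex of a circuit has three edges, and at most two of them can be parallel. -/
theorem three_le_ncard_verts [Finite V] (hK : IsCircuitClass P E K) (hP : GenericConfig P)
    (hdiag : ∀ e ∈ E, ¬ e.ends.IsDiag) : 3 ≤ (verts K).ncard := by
  obtain ⟨e, he⟩ := hK.nonempty
  obtain ⟨C, hC, heC, -, hCK⟩ := hK.exists_circuit e he e he
  have hdiagC : ∀ g ∈ C, ¬ g.ends.IsDiag := fun g hg => hdiag g (hK.subset (hCK hg))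
  obtain ⟨v, b, hvb⟩ := exists_ends_eq e
  have hdeg := hP.three_le_degree hC hdiagC (mem_verts_left heC hvb)
  obtain ⟨T, hT, hTc⟩ := Set.exists_subset_card_eq hdeg
  obtain ⟨e₁, e₂, e₃, h12, h13, h23, rfl⟩ := Set.ncard_eq_three.1 hTc
  obtain ⟨h1, a₁, ha₁⟩ := hT (show e₁ ∈ _ by simp)
  obtain ⟨h2, a₂, ha₂⟩ := hT (show e₂ ∈ _ by simp)
  obtain ⟨h3, a₃, ha₃⟩ := hT (show e₃ ∈ _ by simp)
  have hne : ∀ {e : MixedEdge V} {a}, e ∈ C → e.ends = s(v, a) → v ≠ a := by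
    intro e a he h
    have := hdiagC e he
    rwa [h, Sym2.mk_isDiag_iff] at this
  suffices ∃ x ∈ verts C, ∃ y ∈ verts C, x ≠ v ∧ y ≠ v ∧ x ≠ y by
    obtain ⟨x, hx, y, hy, hxv, hyv, hxy⟩ := this
    rw [← Set.ncard_eq_three.2 ⟨v, x, y, hxv.symm, hyv.symm, hxy, rfl⟩]
    refine Set.ncard_le_ncard ?_ (Set.toFinite _)
    rintro w (rfl | rfl | rfl)
    · exact mem_verts_left he hvb
    · exact verts_mono hCK hx
    · exact verts_mono hCK hy
  by_cases h : a₁ = a₂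
  · refine ⟨a₁, mem_verts_right h1 ha₁, a₃, mem_verts_right h3 ha₃, (hne h1 ha₁).symm,
      (hne h3 ha₃).symm, ?_⟩
    rintro rfl
    subst h
    have k12 : e₁.unit ≠ e₂.unit := fun h => h12 (ext_unit_ends h (ha₁.trans ha₂.symm))
    have k13 : e₁.unit ≠ e₃.unit := fun h => h13 (ext_unit_ends h (ha₁.trans ha₃.symm))
    have k23 : e₂.unit ≠ e₃.unit := fun h => h23 (ext_unit_ends h (ha₂.trans ha₃.symm))
    rcases unit_eq_or e₁ with h | h <;> rcases unit_eq_or e₂ with h' | h' <;>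
      rcases unit_eq_or e₃ with h'' | h'' <;>
      first
      | exact k12 (h.trans h'.symm)
      | exact k13 (h.trans h''.symm)
      | exact k23 (h'.trans h''.symm)
  · exact ⟨a₁, mem_verts_right h1 ha₁, a₂, mem_verts_right h2 ha₂, (hne h1 ha₁).symm,
      (hne h2 ha₂).symm, h⟩

end IsCircuitClass

theorem SimpleGraph.Reachable.mem_of_closed {W : Type*} {H : SimpleGraph W} {A : Set W}
    (hA : ∀ x ∈ A, ∀ y, H.Adj x y → y ∈ A) {x y : W} (h : H.Reachable x y) (hx : x ∈ A) :
    y ∈ A := by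
  obtain ⟨w⟩ := h
  induction w with
  | nil => exact hx
  | cons hadj _ ih => exact ih (hA _ hx _ hadj)

namespace MixedGraph

variable {V : Type*} {G : MixedGraph V}

/-- The subgraph of `G` that is formed by a set of edges and their end vertices. -/
def Subgraph.ofEdges (G : MixedGraph V) (K : Set (MixedEdge V)) (hK : K ⊆ G.edges) :
    G.Subgraph where
  verts := MixedEdge.verts K
  D := SimpleGraph.fromEdgeSet {s | Sum.inl s ∈ K}
  L := SimpleGraph.fromEdgeSet {s | Sum.inr s ∈ K}
  D_le _ _ h := inl_mem_edges.1 (hK ((SimpleGraph.fromEdgeSet_adj _).1 h).1)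
  L_le _ _ h := inr_mem_edges.1 (hK ((SimpleGraph.fromEdgeSet_adj _).1 h).1)
  D_verts _ _ h := ⟨mem_verts_left ((SimpleGraph.fromEdgeSet_adj _).1 h).1 rfl,
    mem_verts_right ((SimpleGraph.fromEdgeSet_adj _).1 h).1 rfl⟩
  L_verts _ _ h := ⟨mem_verts_left ((SimpleGraph.fromEdgeSet_adj _).1 h).1 rfl,
    mem_verts_right ((SimpleGraph.fromEdgeSet_adj _).1 h).1 rfl⟩

theorem TwoConnected.verts_union_verts_sdiff [Finite V] (h : G.TwoConnected)
    (K : Set (MixedEdge V)) : verts K ∪ verts (G.edges \ K) = Set.univ := by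
  refine Set.eq_univ_of_forall fun x => ?_
  obtain ⟨e, he, hx⟩ := h.exists_mem_edges x
  by_cases heK : e ∈ K
  · exact Or.inl ⟨e, heK, hx⟩
  · exact Or.inr ⟨e, ⟨he, heK⟩, hx⟩

theorem isUnion_ofEdges {K : Set (MixedEdge V)} (hK : K ⊆ G.edges)
    (hV : verts K ∪ verts (G.edges \ K) = Set.univ) :
    G.IsUnion (Subgraph.ofEdges G K hK) (Subgraph.ofEdges G (G.edges \ K) Set.sdiff_subset) := by
  refine ⟨hV, ?_, ?_⟩
  · ext a b
    simp only [Subgraph.ofEdges, SimpleGraph.sup_adj, SimpleGraph.fromEdgeSet_adj,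
      Set.mem_ofPred_eq, Set.mem_sdiff]
    have h1 : (Sum.inl s(a, b) : MixedEdge V) ∈ G.edges ↔ G.D.Adj a b := inl_mem_edges
    have h2 := @hK (Sum.inl s(a, b))
    have h3 : G.D.Adj a b → a ≠ b := fun h => h.ne
    tauto
  · ext a b
    simp only [Subgraph.ofEdges, SimpleGraph.sup_adj, SimpleGraph.fromEdgeSet_adj,
      Set.mem_ofPred_eq, Set.mem_sdiff]
    have h1 : (Sum.inr s(a, b) : MixedEdge V) ∈ G.edges ↔ G.L.Adj a b := inr_mem_edges
    have h2 := @hK (Sum.inr s(a, b))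
    have h3 : G.L.Adj a b → a ≠ b := fun h => h.ne
    tauto

/-- In a 2-connected graph, a part of the edge set has at least two vertices of attachment. -/
theorem TwoConnected.two_le_ncard_inter [Finite V] (h : G.TwoConnected) {K : Set (MixedEdge V)}
    (hK : 2 ≤ (verts K).ncard) (hO : 2 ≤ (verts (G.edges \ K)).ncard) :
    2 ≤ (verts K ∩ verts (G.edges \ K)).ncard := by
  by_contra! hlt
  have := h.nontrivial
  obtain ⟨y, hy⟩ : ∃ y, verts K ∩ verts (G.edges \ K) ⊆ {y} := by
    rcases Set.eq_empty_or_nonempty (verts K ∩ verts (G.edges \ K)) with he | hne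
    · exact ⟨Classical.arbitrary V, by simp [he]⟩
    · have h1 := (Set.ncard_pos (Set.toFinite _)).2 hne
      obtain ⟨y, hy⟩ := Set.ncard_eq_one.1 (show (verts K ∩ verts (G.edges \ K)).ncard = 1 by omega)
      exact ⟨y, hy.subset⟩
  obtain ⟨x, hx, hxy⟩ := Set.exists_ne_of_one_lt_ncard (show 1 < (verts K).ncard by omega) y
  obtain ⟨x', hx', hxy'⟩ :=
    Set.exists_ne_of_one_lt_ncard (show 1 < (verts (G.edges \ K)).ncard by omega) y
  -- A path avoiding the only possible attachment vertex `y` can never leave `verts K`.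
  have hreach := (h.2.2 y).preconnected ⟨x, hxy⟩ ⟨x', hxy'⟩
  have := hreach.mem_of_closed (A := {w : ({y}ᶜ : Set V) | (w : V) ∈ verts K}) ?_ hx
  · exact hxy' (hy ⟨this, hx'⟩)
  · rintro ⟨w, hwy⟩ hw ⟨w', hwy'⟩ hadj
    obtain ⟨e, he, hends⟩ := adj_iff_exists_mem_edges.1 (show (G.D ⊔ G.L).Adj w w' from hadj)
    by_cases heK : e ∈ K
    · exact mem_verts_right heK hends
    · have hwO : w ∈ verts (G.edges \ K) := mem_verts_left (show e ∈ G.edges \ K from ⟨he, heK⟩) hends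
      exact absurd (hy ⟨hw, hwO⟩) hwy

/-- In a direction-balanced graph, a part of the edge set without direction edges has at least three
vertices of attachment. -/
theorem DirectionBalanced.three_le_ncard_inter [Finite V] (hbal : G.DirectionBalanced)
    (hconn : G.TwoConnected) {K : Set (MixedEdge V)} (hKE : K ⊆ G.edges)
    (hK : 3 ≤ (verts K).ncard) (hO : 3 ≤ (verts (G.edges \ K)).ncard)
    (hlen : ¬ ∃ e ∈ K, e.IsDir) : 3 ≤ (verts K ∩ verts (G.edges \ K)).ncard := by
  by_contra! hlt
  have h2 := hconn.two_le_ncard_inter (K := K) (by omega) (by omega)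
  obtain ⟨u, v, huv, hinter⟩ := Set.ncard_eq_two.1
    (show (verts K ∩ verts (G.edges \ K)).ncard = 2 by omega)
  have hdiff : ∀ {A B : Set V}, 3 ≤ A.ncard → (A ∩ B).ncard < 3 → (A \ B).Nonempty := by
    intro A B hA hAB
    by_contra hne
    rw [Set.not_nonempty_iff_eq_empty, Set.sdiff_eq_empty] at hne
    rw [Set.inter_eq_left.2 hne] at hAB
    omega
  obtain ⟨⟨s, hs, -⟩, -⟩ := hbal _ _ u v huv
    (isUnion_ofEdges hKE (hconn.verts_union_verts_sdiff K)) hinter (hdiff hK hlt)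
    (hdiff hO (by rwa [Set.inter_comm]))
  refine hlen ⟨Sum.inl s, ?_, s, rfl⟩
  rw [Subgraph.ofEdges, SimpleGraph.edgeSet_fromEdgeSet] at hs
  exact hs.1

end MixedGraph

/-- If each point lies in a part, then the numbers of points of the parts, minus half the numbers of
points that they share with other parts, sum up to at least the number of points. -/
theorem two_mul_card_add_sum_le {V κ : Type*} [Fintype V] (s : Finset κ) (A Y : κ → Set V)
    (hcov : ∀ v, ∃ k ∈ s, v ∈ A k)
    (hY : ∀ k ∈ s, ∀ v ∈ Y k, v ∈ A k ∧ ∃ k' ∈ s, k' ≠ k ∧ v ∈ A k') :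
    2 * Fintype.card V + ∑ k ∈ s, (Y k).ncard ≤ ∑ k ∈ s, 2 * (A k).ncard := by
  classical
  have hn : ∀ B : Set V, B.ncard = ∑ v, if v ∈ B then 1 else 0 := by
    intro B
    rw [← Finset.card_filter, ← Set.ncard_coe_finset]
    congr 1
    ext; simp
  simp_rw [hn, Finset.mul_sum]
  rw [Finset.sum_comm, Finset.sum_comm (s := s), ← Finset.card_univ, Finset.card_eq_sum_ones,
    Finset.mul_sum, ← Finset.sum_add_distrib]
  refine Finset.sum_le_sum fun v _ => ?_
  rw [← Finset.mul_sum, ← Finset.card_filter, ← Finset.card_filter]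
  obtain ⟨k, hk, hvk⟩ := hcov v
  have hkm : k ∈ s.filter fun k => v ∈ A k := Finset.mem_filter.2 ⟨hk, hvk⟩
  have hsub : (s.filter fun k => v ∈ Y k) ⊆ s.filter fun k => v ∈ A k :=
    fun k hk => Finset.mem_filter.2 ⟨(Finset.mem_filter.1 hk).1,
      (hY k (Finset.mem_filter.1 hk).1 v (Finset.mem_filter.1 hk).2).1⟩
  have hle := Finset.card_le_card hsub
  -- For a point in `m` parts: if it lies in no `Y k`, then `2 ≤ 2m` suffices; otherwise `m ≥ 2` and
  -- it lies in at most `m` of the `Y k`, so `2 + m ≤ 2m`.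
  rcases (s.filter fun k => v ∈ Y k).eq_empty_or_nonempty with he | ⟨j, hj⟩
  · rw [he, Finset.card_empty]
    have := Finset.card_pos.2 ⟨k, hkm⟩
    omega
  · obtain ⟨hjs, hjY⟩ := Finset.mem_filter.1 hj
    obtain ⟨-, k', hk', hne, hvk'⟩ := hY j hjs v hjY
    have : 1 < (s.filter fun k => v ∈ A k).card :=
      Finset.one_lt_card.2 ⟨j, hsub hj, k', Finset.mem_filter.2 ⟨hk', hvk'⟩, hne.symm⟩
    omega

/-! ### From redundant rigidity to M-connectedness. -/

namespace MixedGraph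

variable {V : Type*} {G : MixedGraph V}

/-- If the matroid had several components, each would have rank at least twice its number of
vertices minus its number of attachment vertices. Independent sets of the components combine to one
of at least `2|V|` edges, which exceeds the bound `2|V| - 2`. -/
theorem RedundantlyRigid.mConnected [Finite V] (hirr : G.DirectionIrreducible)
    (hconn : G.TwoConnected) (hbal : G.DirectionBalanced) (hR : G.RedundantlyRigid) :
    G.MConnected := by
  classical
  have := Fintype.ofFinite V
  obtain ⟨p, hp, hred⟩ := hR
  have hP := hp.genericConfig
  set P := toComplex ∘ p with hPdef
  unfold MConnected
  rw [G.rigidityMatroid_eq hp]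
  set M := G.frameworkMatroid p with hM
  have hcirc : ∀ {C}, M.IsCircuit C ↔ C ⊆ G.edges ∧ IsMinDep (constraint P) C :=
    frameworkMatroid_isCircuit
  have hdiag : ∀ e ∈ G.edges, ¬ e.ends.IsDiag := fun e he => not_isDiag_of_mem_edges he
  -- No coloops: motions of `G - e` are constant, hence satisfy the constraint of `e`.
  have hloop : ∀ e ∈ G.edges, ∃ C, M.IsCircuit C ∧ e ∈ C := by
    intro e he
    have hrig := FrameworkRigid.infinitesimallyRigid hp (hred e he)
    obtain ⟨C, hC, heC, hsub⟩ := exists_isMinDep_of_forall_apply_eq_zero (constraint P)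
      (S := G.edges \ {e}) (e := e) (fun h => h.2 rfl) fun u hu => by
        have hconst := hrig u fun f hf => hu f (by rwa [← edges_deleteEdge])
        obtain ⟨a, b, hab⟩ := exists_ends_eq e
        rw [constraint_apply hab, hconst a b, sub_self, map_zero, mul_zero, Complex.zero_re]
    rw [Set.insert_sdiff_singleton, Set.insert_eq_of_mem he] at hsub
    exact ⟨C, hcirc.2 ⟨hsub, hC⟩, heC⟩
  by_contra hcon
  unfold Matroid.IsConnected at hcon
  push Not at hcon
  obtain ⟨e₀, he₀, f₀, hf₀, hne₀, hno⟩ := hcon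
  have he₀ : e₀ ∈ G.edges := he₀
  have hf₀ : f₀ ∈ G.edges := hf₀
  let cls : MixedEdge V → Set (MixedEdge V) := fun e => {f ∈ G.edges | M.Linked e f}
  have hself : ∀ {e}, e ∈ G.edges → e ∈ cls e := fun he => ⟨he, Or.inl rfl⟩
  have hclass : ∀ e ∈ G.edges, IsCircuitClass P G.edges (cls e) := by
    intro e he
    have hsub : ∀ C ⊆ G.edges, IsMinDep (constraint P) C → ∀ f ∈ cls e, f ∈ C → C ⊆ cls e :=
      fun C hCE hC f hf hfC g hg =>
        ⟨hCE hg, hf.2.trans (Or.inr ⟨C, hcirc.2 ⟨hCE, hC⟩, hfC, hg⟩)⟩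
    refine ⟨fun f hf => hf.1, ⟨e, hself he⟩, hsub, fun f hf g hg => ?_⟩
    obtain ⟨C, hC, hfC, hgC⟩ : ∃ C, M.IsCircuit C ∧ f ∈ C ∧ g ∈ C := by
      rcases hf.2.symm.trans hg.2 with rfl | h
      · obtain ⟨C, hC, hfC⟩ := hloop f hf.1
        exact ⟨C, hC, hfC, hfC⟩
      · exact h
    have hC' := hcirc.1 hC
    exact ⟨C, hC'.2, hfC, hgC, hsub C hC'.1 hC'.2 f hf hfC⟩
  have heq : ∀ e f g, g ∈ cls e → g ∈ cls f → cls e = cls f := by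
    intro e f g hg hg'
    ext h
    refine ⟨fun hh => ⟨hh.1, ?_⟩, fun hh => ⟨hh.1, ?_⟩⟩
    · exact (hg'.2.trans hg.2.symm).trans hh.2
    · exact (hg.2.trans hg'.2.symm).trans hh.2
  let s : Finset (Set (MixedEdge V)) := (Set.toFinite (cls '' G.edges)).toFinset
  have hs : ∀ {K}, K ∈ s ↔ ∃ e ∈ G.edges, cls e = K := by
    intro K; simp [s]
  have hsdisj : ∀ K ∈ s, ∀ K' ∈ s, ∀ g, g ∈ K → g ∈ K' → K = K' := by
    intro K hK K' hK' g hg hg'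
    obtain ⟨e, -, rfl⟩ := hs.1 hK
    obtain ⟨f, -, rfl⟩ := hs.1 hK'
    exact heq e f g hg hg'
  have hscls : ∀ K ∈ s, IsCircuitClass P G.edges K := by
    intro K hK
    obtain ⟨e, he, rfl⟩ := hs.1 hK
    exact hclass e he
  have hlen : ∀ K ∈ s, ∃ e ∈ K, ¬ e.IsDir := by
    intro K hK
    obtain ⟨e, he⟩ := (hscls K hK).nonempty
    obtain ⟨C, hC, -, -, hCK⟩ := (hscls K hK).exists_circuit e he e he
    obtain ⟨f, hf, hfd⟩ :=
      exists_not_isDir_of_isCircuit hirr hp (hCK.trans (hscls K hK).subset) hC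
    exact ⟨f, hCK hf, hfd⟩
  have hother : ∀ K ∈ s, 3 ≤ (verts (G.edges \ K)).ncard := by
    intro K hK
    -- A second component exists because `e₀` and `f₀` lie in no common circuit.
    obtain ⟨K', hK', hKK'⟩ : ∃ K' ∈ s, K' ≠ K := by
      by_contra! hall
      have h1 := hall _ (hs.2 ⟨e₀, he₀, rfl⟩)
      have h2 := hall _ (hs.2 ⟨f₀, hf₀, rfl⟩)
      have h3 : f₀ ∈ cls e₀ := by
        rw [h1, ← h2]; exact hself hf₀
      rcases h3.2 with h | ⟨C, hC, he, hf⟩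
      · exact hne₀ h
      · exact hno C hC he hf
    refine ((hscls K' hK').three_le_ncard_verts hP hdiag).trans
      (Set.ncard_le_ncard (verts_mono ?_) (Set.toFinite _))
    exact fun g hg => ⟨(hscls K' hK').subset hg, fun hgK => hKK' (hsdisj K' hK' K hK g hg hgK)⟩
  choose! b hbK hbind hbcard using fun K (hK : K ∈ s) =>
    (hscls K hK).exists_linearIndepOn hP hdiag (hlen K hK)
  -- The defect of the rank, `2` or `3`, is matched by the number of attachment vertices: `2` from
  -- 2-connectedness, `3` from direction balance when there is no direction edge.
  have hK2 : ∀ K ∈ s, 2 * (verts K).ncard ≤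
      (b K).ncard + (verts K ∩ verts (G.edges \ K)).ncard := by
    intro K hK
    refine (hbcard K hK).trans (Nat.add_le_add_left ?_ _)
    have h3 := (hscls K hK).three_le_ncard_verts hP hdiag
    have h3' := hother K hK
    split_ifs with hd
    · exact hconn.two_le_ncard_inter (by omega) (by omega)
    · exact hbal.three_le_ncard_inter hconn (hscls K hK).subset h3 h3' hd
  have hsum := Finset.sum_le_sum hK2
  have hcount := two_mul_card_add_sum_le s verts
    (fun K => verts K ∩ verts (G.edges \ K)) (fun v => by
      obtain ⟨e, he, hv⟩ := hconn.exists_mem_edges v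
      exact ⟨cls e, hs.2 ⟨e, he, rfl⟩, e, hself he, hv⟩)
    (fun K hK v ⟨hvK, e, he, hv⟩ => ⟨hvK, cls e, hs.2 ⟨e, he.1, rfl⟩, fun h => he.2 (h ▸ hself he.1),
      e, hself he.1, hv⟩)
  rw [Finset.sum_add_distrib] at hsum
  let B : Finset (MixedEdge V) := s.biUnion fun K => (b K).toFinite.toFinset
  have hBmem : ∀ {e}, e ∈ B ↔ ∃ K ∈ s, e ∈ b K := by
    intro e; simp [B]
  have hBcard : B.card = ∑ K ∈ s, (b K).ncard := by
    rw [Finset.card_biUnion]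
    · exact Finset.sum_congr rfl fun K _ => (Set.ncard_eq_toFinset_card (b K)).symm
    · intro K hK K' hK' hne
      rw [Function.onFun, Finset.disjoint_left]
      intro g hg hg'
      rw [Set.Finite.mem_toFinset] at hg hg'
      exact hne (hsdisj K hK K' hK' g (hbK K hK hg) (hbK K' hK' hg'))
  have hBE : (B : Set (MixedEdge V)) ⊆ G.edges := by
    intro e he
    obtain ⟨K, hK, heK⟩ := hBmem.1 he
    exact (hscls K hK).subset (hbK K hK heK)
  -- A circuit inside the union would lie in a single component, where the chosen set is
  -- independent.
  have hBind : LinearIndepOn ℝ (constraint P) (B : Set (MixedEdge V)) := by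
    by_contra hdep
    have hd : M.Dep (B : Set (MixedEdge V)) :=
      ⟨fun h => hdep (frameworkMatroid_indep.1 h).2, hBE⟩
    obtain ⟨C, hCB, hC⟩ := hd.exists_isCircuit_subset
    obtain ⟨e, he⟩ := hC.nonempty
    obtain ⟨K, hK, heK⟩ := hBmem.1 (hCB he)
    have hC' := hcirc.1 hC
    have hCK := (hscls K hK).circuit_subset C hC'.1 hC'.2 e (hbK K hK heK) he
    refine hC'.2.1 ((hbind K hK).mono fun g hg => ?_)
    obtain ⟨K', hK', hgK'⟩ := hBmem.1 (hCB hg)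
    rwa [hsdisj K hK K' hK' g (hCK hg) (hbK K' hK' hgK')]
  have hfin := ncard_add_two_le hBind (X := Set.univ)
    (by have := hconn.nontrivial; exact Set.univ_nonempty) (Set.subset_univ _)
  rw [Set.ncard_coe_finset, Set.ncard_univ, Nat.card_eq_fintype_card] at hfin
  omega

end MixedGraph

theorem mainTheorem8 {V : Type*} [Finite V] (G : MixedGraph V) (hD : G.D ≠ ⊥)
    (hirr : G.DirectionIrreducible) (hconn : G.TwoConnected) (hbal : G.DirectionBalanced) :
    G.MConnected ↔ G.RedundantlyRigid := by
  exact ⟨fun h => h.redundantlyRigid hD hirr hconn,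
    fun h => h.mConnected hirr hconn hbal⟩
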